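/- **Theorem (Maximum principle).** Let $\mathbf E_1^3$ be $\mathbb R^3$ with the Lorentzian metric $\langle u,v\rangle=u_1v_1+u_2v_2-u_3v_3$. Let $S_1,S_2$ be smooth spacelike surfaces in $\mathbf E_1^3$, possibly with boundary, that is, $S_i$ is given by a smooth immersion $x_i:M_i\to\mathbf E_1^3$ of a smooth surface with (possibly empty) boundary whose tangent planes are all spacelike. Let $N_i$ be a smooth unit normal field ($\langle N_i,N_i\rangle=-1$) along $x_i$ and let $H_i=-\tfrac12\operatorname{trace}A_i$ be the mean curvature, where $A_i=-dN_i$ is the Weingarten endomorphism. Suppose that $H_1$ and $H_2$ are constant and equal to the same real number. Let $q_i\in M_i$ with $x_1(q_1)=x_2(q_2)=p$ and $N_1(q_1)=N_2(q_2)=:N$; in particular $S_1$ and $S_2$ have the same tangent plane $P=p+N^\perp$ at $p$. If $q_1\in\partial M_1$ and $q_2\in\partial M_2$, suppose moreover that $\partial S_1$ and $\partial S_2$ have the same tangent line and that $S_1$ and $S_2$ have the same interior unit conormal vector at $p$. Suppose that $S_1\le S_2$ around $p$: near $q_1$ and $q_2$ the surfaces are graphs $\{p+w+u_i(w)N : w\in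 D_i\}$ of functions $u_i$ on sets $D_i\subset N^\perp$, and $u_1\le u_2$ on $D_1\cap D_2$. Then $S_1$ and $S_2$ coincide in a neighbourhood of $p$, in the following sense. 1. There are neighbourhoods $V_i$ of $q_i$ such that $x_1(V_1)$ and $x_2(V_2)$ are graphs over sets $D_1,D_2\subset N^\perp$ of one and the same function $u$; that is, the surfaces agree wherever both are defined as graphs over $P$. 2. If $q_1$ and $q_2$ are both interior points, or if near $p$ the surfaces are graphs over the same part of $P$ (the projections of $S_1$ and $S_2$ to $P$ along $N$ agree on arbitrarily small neighbourhoods of $q_1$ and $q_2$), then $S_1=S_2$ near $p$: there are arbitrarily small neighbourhoods $V_i$ of $q_i$ with $x_1(V_1)=x_2(V_2)$. -/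

import Mathlib

open scoped Manifold ContDiff Topology

noncomputable section

namespace LorentzMinkowski

/-- The underlying space of the Lorentz-Minkowski space `E_1^3`. -/
abbrev E3 : Type := EuclideanSpace ℝ (Fin 3)

/-- The parameter plane. -/
abbrev E2 : Type := EuclideanSpace ℝ (Fin 2)

/-- The Lorentzian metric `⟨u,v⟩ = u₀ v₀ + u₁ v₁ - u₂ v₂`. -/
def lorentz (u v : E3) : ℝ := u 0 * v 0 + u 1 * v 1 - u 2 * v 2

section Surface

variable {M : Type*} [TopologicalSpace M] [ChartedSpace (EuclideanHalfSpace 2) M]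

/-- The differential at `q` of a map from a surface with boundary to `E_1^3`. The tangent space
`T_q M` is identified with the plane through the preferred chart at `q` (Mathlib's convention). -/
def differential (f : M → E3) (q : M) : E2 →L[ℝ] E3 :=
  mfderiv (𝓡∂ 2) 𝓘(ℝ, E3) f q

/-- `x` is a (smooth) spacelike immersion: all its tangent planes are spacelike. -/
structure IsSpacelikeImmersion (x : M → E3) : Prop where
  smooth : ContMDiff (𝓡∂ 2) 𝓘(ℝ, E3) ∞ x
  injective : ∀ q, Function.Injective (differential x q)
  spacelike : ∀ q (v : E2), v ≠ 0 → 0 < lorentz (differential x q v) (differential x q v)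

/-- `N` is a Gauss map (an orientation) of `x`: a smooth unit normal vector field along `x`. The
normal is timelike, so unit means `⟨N,N⟩ = -1`; both time orientations are allowed. -/
structure IsGaussMap (x N : M → E3) : Prop where
  smooth : ContMDiff (𝓡∂ 2) 𝓘(ℝ, E3) ∞ N
  unit : ∀ q, lorentz (N q) (N q) = -1
  normal : ∀ q (v : E2), lorentz (N q) (differential x q v) = 0

/-- The matrix of the first fundamental form in the coordinate basis of `T_q M`. -/
def firstForm (x : M → E3) (q : M) : Matrix (Fin 2) (Fin 2) ℝ :=
  Matrix.of fun i j =>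
    lorentz (differential x q (EuclideanSpace.single i 1))
      (differential x q (EuclideanSpace.single j 1))

/-- The matrix of the second fundamental form `σ(u,v) = -⟨dN(u), dx(v)⟩` in the coordinate basis
of `T_q M`. -/
def secondForm (x N : M → E3) (q : M) : Matrix (Fin 2) (Fin 2) ℝ :=
  Matrix.of fun i j =>
    -lorentz (differential N q (EuclideanSpace.single i 1))
      (differential x q (EuclideanSpace.single j 1))

/-- The matrix of the Weingarten endomorphism `A` of `T_q M`, where `⟨A u, v⟩ = σ(u,v)`. -/
def weingarten (x N : M → E3) (q : M) : Matrix (Fin 2) (Fin 2) ℝ :=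
  (firstForm x q)⁻¹ * secondForm x N q

/-- The mean curvature `H = -(1/2) trace A` with respect to the orientation `N`. -/
def meanCurvature (x N : M → E3) (q : M) : ℝ :=
  -(1 / 2) * (weingarten x N q).trace

/-- The tangent line `T_p ∂S`, `p = x q`, at a boundary point `q`, as a subset of `E_1^3`. The
half-space model is `{y | 0 ≤ y 0}`, so that the vectors `v` of `T_q M` tangent to the boundary
are those with `v 0 = 0` (and those with `0 < v 0` point to the interior). -/
def boundaryTangentLine (x : M → E3) (q : M) : Set E3 :=
  {y | ∃ v : E2, v 0 = 0 ∧ y = differential x q v}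

/-- `ν` is the interior unit conormal vector of `x` at the boundary point `q`. -/
def IsInteriorConormal (x : M → E3) (q : M) (ν : E3) : Prop :=
  (∃ v : E2, 0 < v 0 ∧ ν = differential x q v) ∧ lorentz ν ν = 1 ∧
    ∀ y ∈ boundaryTangentLine x q, lorentz ν y = 0

end Surface

/-- `S` is the graph of the function `u` defined on a subset `D` of the plane `N^⊥`, this plane
being placed at `p` and heights being measured along `N`. -/
def IsGraphOver (p N : E3) (S : Set E3) (D : Set E3) (u : E3 → ℝ) : Prop :=
  (∀ w ∈ D, lorentz w N = 0) ∧ S = {y | ∃ w ∈ D, y = p + w + u w • N}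

/-- The projection of `E_1^3` onto `N^⊥` along the unit timelike vector `N`, with origin `p`. -/
def tangentProj (p N : E3) (y : E3) : E3 := (y - p) + lorentz (y - p) N • N

section Pair

variable {M₁ M₂ : Type*} [TopologicalSpace M₁] [TopologicalSpace M₂]

/-- `S₁ ≤ S₂` around `p`: near `q₁` and `q₂` the two surfaces are graphs of functions `u₁`, `u₂`
on parts of the plane `p + N^⊥`, and `u₁ ≤ u₂` wherever both are defined. -/
def LiesBelow (p N : E3) (x₁ : M₁ → E3) (q₁ : M₁) (x₂ : M₂ → E3) (q₂ : M₂) : Prop :=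
  ∃ V₁ ∈ 𝓝 q₁, ∃ V₂ ∈ 𝓝 q₂, ∃ D₁ D₂ : Set E3, ∃ u₁ u₂ : E3 → ℝ,
    IsGraphOver p N (x₁ '' V₁) D₁ u₁ ∧ IsGraphOver p N (x₂ '' V₂) D₂ u₂ ∧
      ∀ w ∈ D₁ ∩ D₂, u₁ w ≤ u₂ w

/-- The images of `f` near `q₁` and of `g` near `q₂` coincide: there are arbitrarily small
neighbourhoods of `q₁` and `q₂` with the same image. -/
def SameGerm (f : M₁ → E3) (q₁ : M₁) (g : M₂ → E3) (q₂ : M₂) : Prop :=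
  ∀ U₁ ∈ 𝓝 q₁, ∀ U₂ ∈ 𝓝 q₂, ∃ V₁ ∈ 𝓝 q₁, ∃ V₂ ∈ 𝓝 q₂,
    V₁ ⊆ U₁ ∧ V₂ ⊆ U₂ ∧ f '' V₁ = g '' V₂

end Pair

end LorentzMinkowski

end

/-! In coordinates adapted to `N`, a spacelike surface through `p` with normal `N` is locally the
graph of a function `u` over the plane `N^⊥`, with zero gradient at the origin. Mean curvature `h`
becomes `(1 - |∇u|²) Δu + D²u(∇u, ∇u) = 2h (1 - |∇u|²)^(3/2)`, which is uniformly elliptic while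
`|∇u| ≤ 1/2`. Subtracting the equations of two graphs, with bounded Hessians, gives for `w = u₂ - u₁
≥ 0` a linear elliptic inequality `|L w| ≤ C |∇w|` without zero-order term
(`IsLocalGraph.isGradientControlled_sub`). Hopf's lemma and the strong maximum principle hold for
such `w`, with a Gaussian barrier.

Interior and boundary points are treated together. Some unit vector `e` points into both projected
surfaces: the common conormal if both points are on the boundary, otherwise the inner direction of
whichever surface may have a boundary. Both domains then contain a ball tangent at the origin with
inner normal `e`. If `w` were positive on that ball, Hopf's lemma would give it positive slope at
the origin, whereas both gradients vanish there; so `w` has a zero in the ball and vanishes on all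
of it. The two boundary curves may differ, but a common point of the domains can be translated along
`e` into the ball inside both of them. Hence `w` vanishes on the open segment, and by continuity at
the point (`IsLocalGraph.eventually_eq`).

Regularity up to the boundary comes from a homeomorphism of the plane extending the projected chart
(`exists_homeomorph_extension_halfPlane`), which yields the local graphs (`exists_isLocalGraph`). -/

namespace LorentzMinkowski

/-! ### Lorentz-orthonormal coordinates adapted to a timelike vector -/

/-- Orthogonal coordinates adapted to the unit timelike vector `N`: `π` is the projection to the
plane `N^⊥` read in an orthonormal basis, and `ht` is the height along `N`. -/
structure IsLorentzFrame (N : E3) (π : E3 →L[ℝ] E2) (ht : E3 →L[ℝ] ℝ) : Prop where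
  lorentz_eq : ∀ u v, lorentz u v = inner ℝ (π u) (π v) - ht u * ht v
  height_eq : ∀ v, ht v = -lorentz v N
  proj_normal : π N = 0

theorem lorentz_comm (u v : E3) : lorentz u v = lorentz v u := by
  simp only [lorentz]; ring

theorem lorentz_nondegenerate {v : E3} (hv : ∀ u, lorentz v u = 0) : v = 0 := by
  ext i
  have h := hv (EuclideanSpace.single i 1)
  fin_cases i <;> simpa [lorentz] using h

/-- `π` and `ht` are the components of the boost taking `N` to the third axis; its spatial block is
`1 + k a aᵀ` with `a = (N 0, N 1)` and `k = 1 / (1 + N 2)`. -/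
theorem exists_isLorentzFrame_of_pos {N : E3} (hN : lorentz N N = -1) (hpos : 0 < N 2) :
    ∃ π ht, IsLorentzFrame N π ht := by
  obtain ⟨k, hk⟩ : ∃ k : ℝ, k * (1 + N 2) = 1 := ⟨(1 + N 2)⁻¹, by field_simp⟩
  have hc : N 2 ^ 2 = 1 + N 0 ^ 2 + N 1 ^ 2 := by
    simp only [lorentz] at hN; linarith
  have hk2 : k * (N 0 ^ 2 + N 1 ^ 2) = N 2 - 1 := by
    linear_combination (N 2 - 1) * hk - k * hc
  refine ⟨LinearMap.toContinuousLinearMap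
    { toFun := fun v => !₂[v 0 * (1 + k * N 0 ^ 2) + v 1 * (k * N 0 * N 1) - v 2 * N 0,
        v 0 * (k * N 0 * N 1) + v 1 * (1 + k * N 1 ^ 2) - v 2 * N 1]
      map_add' := fun u v => by ext i; fin_cases i <;> simp <;> ring
      map_smul' := fun r v => by ext i; fin_cases i <;> simp <;> ring },
    LinearMap.toContinuousLinearMap
    { toFun := fun v => -lorentz v N
      map_add' := fun u v => by simp [lorentz]; ring
      map_smul' := fun r v => by simp [lorentz]; ring }, ?_, fun v => by simp, ?_⟩
  · intro u v
    simp only [lorentz, LinearMap.coe_toContinuousLinearMap', LinearMap.coe_mk, AddHom.coe_mk,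
      PiLp.inner_apply, Fin.sum_univ_two, RCLike.inner_apply, conj_trivial, Matrix.cons_val_zero,
      Matrix.cons_val_one]
    generalize N 0 = a at *
    generalize N 1 = b at *
    generalize N 2 = c at *
    have h00 : (1 + k * a ^ 2) ^ 2 + (k * a * b) ^ 2 - a ^ 2 = 1 := by
      linear_combination k * a ^ 2 * hk2 + a ^ 2 * hk
    have h11 : (1 + k * b ^ 2) ^ 2 + (k * a * b) ^ 2 - b ^ 2 = 1 := by
      linear_combination k * b ^ 2 * hk2 + b ^ 2 * hk
    have h01 : (1 + k * a ^ 2) * (k * a * b) + (k * a * b) * (1 + k * b ^ 2) - a * b = 0 := by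
      linear_combination k * a * b * hk2 + a * b * hk
    have h02 : -(1 + k * a ^ 2) * a - (k * a * b) * b + a * c = 0 := by
      linear_combination -a * hk2
    have h12 : -(1 + k * b ^ 2) * b - (k * a * b) * a + b * c = 0 := by
      linear_combination -b * hk2
    linear_combination (-u 0 * v 0) * h00 - u 1 * v 1 * h11 - (u 0 * v 1 + u 1 * v 0) * h01
      - (u 0 * v 2 + u 2 * v 0) * h02 - (u 1 * v 2 + u 2 * v 1) * h12 + u 2 * v 2 * hc
  · ext i
    fin_cases i <;> simp
    · linear_combination N 0 * hk2
    · linear_combination N 1 * hk2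

theorem exists_isLorentzFrame {N : E3} (hN : lorentz N N = -1) :
    ∃ π ht, IsLorentzFrame N π ht := by
  rcases lt_trichotomy (N 2) 0 with hneg | h0 | hpos
  · obtain ⟨π, ht, hF⟩ := exists_isLorentzFrame_of_pos (N := -N)
      (by simpa [lorentz] using hN) (by simpa using hneg)
    refine ⟨π, -ht, fun u v => by simpa using hF.lorentz_eq u v, fun v => ?_, ?_⟩
    · have := hF.height_eq v
      simp only [lorentz, PiLp.neg_apply] at this
      simp only [neg_apply, this, lorentz]
      ring
    · simpa using hF.proj_normal
  · simp only [lorentz, h0] at hN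
    nlinarith [sq_nonneg (N 0), sq_nonneg (N 1)]
  · exact exists_isLorentzFrame_of_pos hN hpos

namespace IsLorentzFrame

variable {N : E3} {π : E3 →L[ℝ] E2} {ht : E3 →L[ℝ] ℝ}

theorem height_normal (hF : IsLorentzFrame N π ht) (hN : lorentz N N = -1) : ht N = 1 := by
  rw [hF.height_eq, hN, neg_neg]

theorem eq_zero (hF : IsLorentzFrame N π ht) {v : E3} (h1 : π v = 0) (h2 : ht v = 0) : v = 0 :=
  lorentz_nondegenerate fun u => by simp [hF.lorentz_eq, h1, h2]

theorem eq_of_eq (hF : IsLorentzFrame N π ht) {v w : E3} (h1 : π v = π w) (h2 : ht v = ht w) :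
    v = w :=
  sub_eq_zero.1 (hF.eq_zero (by rw [map_sub, h1, sub_self]) (by rw [map_sub, h2, sub_self]))

theorem proj_tangentProj (hF : IsLorentzFrame N π ht) (p y : E3) :
    π (tangentProj p N y) = π (y - p) := by
  simp [tangentProj, hF.proj_normal]

end IsLorentzFrame

/-! ### The mean curvature equation of a graph -/

/-- The trace of an endomorphism of the plane in the standard basis. -/
noncomputable def planeTrace (Q : E2 →L[ℝ] E2) : ℝ :=
  Q (EuclideanSpace.single 0 1) 0 + Q (EuclideanSpace.single 1 1) 1

/-- The principal part of the mean curvature operator of spacelike graphs with gradient `p`,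
applied to a Hessian `Q`. -/
noncomputable def graphOperator (p : E2) (Q : E2 →L[ℝ] E2) : ℝ :=
  (1 - ‖p‖ ^ 2) * planeTrace Q + inner ℝ p (Q p)

/-- The matrix of the bilinear form `⟨S u, T v⟩` in the standard basis. -/
noncomputable def formMatrix (S T : E2 →L[ℝ] E3) : Matrix (Fin 2) (Fin 2) ℝ :=
  Matrix.of fun i j => lorentz (S (EuclideanSpace.single i 1)) (T (EuclideanSpace.single j 1))

/-- The mean curvature of a surface with differential `T` whose unit normal has differential `S`. -/
noncomputable def pointMeanCurvature (T S : E2 →L[ℝ] E3) : ℝ :=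
  -(1 / 2) * ((formMatrix T T)⁻¹ * -formMatrix S T).trace

theorem formMatrix_comp (S T : E2 →L[ℝ] E3) (L : E2 →L[ℝ] E2) :
    formMatrix (S ∘L L) (T ∘L L) =
      (Matrix.of fun i j => L (EuclideanSpace.single j 1) i).transpose * formMatrix S T *
        (Matrix.of fun i j => L (EuclideanSpace.single j 1) i) := by
  have hb : ∀ v : E2, v = v 0 • EuclideanSpace.single 0 1 + v 1 • EuclideanSpace.single 1 1 := by
    intro v; ext i; fin_cases i <;> simp
  ext i j
  simp only [formMatrix, Matrix.of_apply, ContinuousLinearMap.comp_apply, Matrix.mul_apply,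
    Fin.sum_univ_two, Matrix.transpose_apply]
  rw [hb (L (EuclideanSpace.single i 1)), hb (L (EuclideanSpace.single j 1))]
  simp [lorentz]
  ring

/-- Both fundamental forms change by the same congruence `lᵀ · l`, so the Weingarten matrix is
conjugated by `l` and keeps its trace. This allows parametrizing by the projection to `N^⊥`. -/
theorem pointMeanCurvature_comp (T S : E2 →L[ℝ] E3) (L : E2 ≃L[ℝ] E2) :
    pointMeanCurvature (T ∘L (L : E2 →L[ℝ] E2)) (S ∘L (L : E2 →L[ℝ] E2)) =
      pointMeanCurvature T S := by
  have hb : ∀ v : E2, v = v 0 • EuclideanSpace.single 0 1 + v 1 • EuclideanSpace.single 1 1 := by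
    intro v; ext i; fin_cases i <;> simp
  set l : Matrix (Fin 2) (Fin 2) ℝ :=
    Matrix.of fun i j => (L : E2 →L[ℝ] E2) (EuclideanSpace.single j 1) i with hl
  set l' : Matrix (Fin 2) (Fin 2) ℝ :=
    Matrix.of fun i j => L.symm (EuclideanSpace.single j 1) i with hl'
  have hinv : l * l' = 1 := by
    ext i j
    have h := congrArg (fun v : E2 => v i) (L.apply_symm_apply (EuclideanSpace.single j 1))
    simp only at h
    rw [hb (L.symm _)] at h
    simp only [map_add, map_smul, PiLp.add_apply, PiLp.smul_apply, smul_eq_mul] at h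
    simp only [hl, hl', Matrix.mul_apply, Fin.sum_univ_two, Matrix.of_apply,
      ContinuousLinearEquiv.coe_coe, Matrix.one_apply]
    rw [mul_comm, mul_comm (L _ i), h]
    simp
  have hu : IsUnit l.det := (Matrix.isUnit_iff_isUnit_det l).1
    ⟨⟨l, l', hinv, mul_eq_one_comm.1 hinv⟩, rfl⟩
  have hut : IsUnit l.transpose.det := by rwa [Matrix.det_transpose]
  unfold pointMeanCurvature
  rw [formMatrix_comp, formMatrix_comp, ← hl, Matrix.mul_inv_rev, Matrix.mul_inv_rev]
  congr 1
  calc _ = (l⁻¹ * ((formMatrix T T)⁻¹ * ((l.transpose⁻¹ * l.transpose) * (-formMatrix S T))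
        * l)).trace := by
        simp only [Matrix.mul_assoc, Matrix.mul_neg, Matrix.neg_mul]
    _ = _ := by
        rw [Matrix.nonsing_inv_mul _ hut, Matrix.one_mul, Matrix.trace_mul_comm, Matrix.mul_assoc,
          Matrix.mul_nonsing_inv _ hu, Matrix.mul_one]

/-- The mean curvature equation of a spacelike graph. -/
theorem graphOperator_eq_of_pointMeanCurvature {N : E3} {π : E3 →L[ℝ] E2} {ht : E3 →L[ℝ] ℝ}
    (hF : IsLorentzFrame N π ht) {T S : E2 →L[ℝ] E3} {Q : E2 →L[ℝ] E2} {n : E3} {ψ : E2} {h : ℝ}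
    (hpos : 0 < ht n) (hn : lorentz n n = -1) (hψ : π n = ht n • ψ)
    (hT : ∀ v, π (T v) = v) (hT' : ∀ v, ht (T v) = inner ℝ ψ v)
    (hQ : ∀ v, π (S v) = ht n • Q v + ht (S v) • ψ) (hh : pointMeanCurvature T S = h) :
    graphOperator ψ Q = 2 * h * Real.sqrt (1 - ‖ψ‖ ^ 2) ^ 3 := by
  set c := ht n with hc
  -- The unit normal of a graph of slope `ψ` is `c (ψ, 1)` with `c = (1 - ‖ψ‖²)^(-1/2)`.
  have h1 : c ^ 2 * (1 - ‖ψ‖ ^ 2) = 1 := by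
    rw [hF.lorentz_eq, hψ, inner_smul_left, inner_smul_right, real_inner_self_eq_norm_sq] at hn
    simp only [conj_trivial] at hn
    linear_combination -hn
  have hs : Real.sqrt (1 - ‖ψ‖ ^ 2) = c⁻¹ := by
    rw [Real.sqrt_eq_iff_mul_self_eq_of_pos (by positivity)]
    field_simp
    linear_combination -h1
  have hnorm : ‖ψ‖ ^ 2 = ψ 0 ^ 2 + ψ 1 ^ 2 := by
    simp [EuclideanSpace.norm_sq_eq, Fin.sum_univ_two]
  have hG : formMatrix T T = !![1 - ψ 0 ^ 2, -(ψ 0 * ψ 1); -(ψ 0 * ψ 1), 1 - ψ 1 ^ 2] := by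
    ext i j
    simp only [formMatrix, Matrix.of_apply, hF.lorentz_eq, hT, hT']
    fin_cases i <;> fin_cases j <;> simp [EuclideanSpace.inner_single_right] <;> ring
  -- The component of `π (S v)` along `ψ` cancels against the height term, leaving `c` times the
  -- Hessian.
  have hS : ∀ i j, formMatrix S T i j = c * Q (EuclideanSpace.single i 1) j := by
    intro i j
    simp only [formMatrix, Matrix.of_apply, hF.lorentz_eq, hT, hT', hQ]
    simp [EuclideanSpace.inner_single_right]
  have hS' : formMatrix S T = !![c * Q (EuclideanSpace.single 0 1) 0,
      c * Q (EuclideanSpace.single 0 1) 1; c * Q (EuclideanSpace.single 1 1) 0,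
      c * Q (EuclideanSpace.single 1 1) 1] := by
    ext i j
    rw [hS]
    fin_cases i <;> fin_cases j <;> rfl
  have hdet : (formMatrix T T).det = 1 - ‖ψ‖ ^ 2 := by
    rw [hG, Matrix.det_fin_two_of, hnorm]; ring
  have hpos' : 1 - ‖ψ‖ ^ 2 ≠ 0 := by
    intro h0; rw [h0] at h1; simp at h1
  have hb : ψ = ψ 0 • EuclideanSpace.single 0 1 + ψ 1 • EuclideanSpace.single 1 1 := by
    ext i; fin_cases i <;> simp
  have hinner : inner ℝ ψ (Q ψ) =
      ψ 0 * (ψ 0 * Q (EuclideanSpace.single 0 1) 0 + ψ 1 * Q (EuclideanSpace.single 1 1) 0) +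
      ψ 1 * (ψ 0 * Q (EuclideanSpace.single 0 1) 1 + ψ 1 * Q (EuclideanSpace.single 1 1) 1) := by
    conv_lhs => rw [hb]
    simp [PiLp.inner_apply, Fin.sum_univ_two]
    ring
  have hcurv : 2 * h * (1 - ‖ψ‖ ^ 2) = c * graphOperator ψ Q := by
    rw [← hh, pointMeanCurvature, Matrix.inv_def, hdet, hG, hS', Matrix.adjugate_fin_two_of,
      Ring.inverse_eq_inv']
    unfold graphOperator planeTrace
    rw [hinner]
    simp [Matrix.trace_fin_two]
    field_simp
    rw [hnorm]
    ring
  rw [hs]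
  field_simp
  linear_combination -c ^ 2 * hcurv + 2 * h * h1

theorem meanCurvature_eq_pointMeanCurvature {M : Type*} [TopologicalSpace M]
    [ChartedSpace (EuclideanHalfSpace 2) M] (x N : M → E3) (q : M) :
    meanCurvature x N q = pointMeanCurvature (differential x q) (differential N q) := by
  rfl

end LorentzMinkowski

namespace LorentzMinkowski

/-! ### The maximum principle for the graph operator -/

/-- A negative second derivative would make `0` a local maximum as well, so `f` would be locally
constant and `d = 0`. -/
theorem nonneg_of_isLocalMin {f g : ℝ → ℝ} {d : ℝ} (hmin : IsLocalMin f 0)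
    (hf : ∀ᶠ t in 𝓝 0, HasDerivAt f (g t) t) (hg : HasDerivAt g d 0) : 0 ≤ d := by
  by_contra! hd
  have hfg : deriv f =ᶠ[𝓝 0] g := hf.mono fun t ht => ht.deriv
  have hd2 : deriv (deriv f) 0 = d := by rw [hfg.deriv_eq, hg.deriv]
  have hmax : IsLocalMax f 0 :=
    isLocalMax_of_deriv_deriv_neg (by rwa [hd2]) hmin.deriv_eq_zero hf.self_of_nhds.continuousAt
  have hc : f =ᶠ[𝓝 0] fun _ => f 0 := by
    filter_upwards [hmin, hmax] with t h1 h2 using le_antisymm h2 h1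
  have hz : deriv f =ᶠ[𝓝 0] fun _ => 0 := by
    filter_upwards [hc.deriv] with t ht
    rw [ht, deriv_const]
  rw [hz.deriv_eq, deriv_const] at hd2
  exact hd.ne hd2.symm

theorem inner_hessian_nonneg_of_isLocalMin {f : E2 → ℝ} {G : E2 → E2} {D : E2 →L[ℝ] E2} {y : E2}
    (hmin : IsLocalMin f y) (hf : ∀ᶠ y' in 𝓝 y, HasGradientAt f (G y') y')
    (hG : HasFDerivAt G D y) (ξ : E2) : 0 ≤ inner ℝ ξ (D ξ) := by
  have hline : ∀ t : ℝ, HasDerivAt (fun t : ℝ => y + t • ξ) ξ t := fun t => by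
    simpa using ((hasDerivAt_id t).smul_const ξ).const_add y
  have hcont : Filter.Tendsto (fun t : ℝ => y + t • ξ) (𝓝 0) (𝓝 y) := by
    simpa using (hline 0).continuousAt.tendsto
  refine nonneg_of_isLocalMin (f := fun t => f (y + t • ξ)) (g := fun t => inner ℝ ξ (G (y + t • ξ)))
    ?_ ?_ ?_
  · have := hcont.eventually hmin
    simpa [IsLocalMin, IsMinFilter] using this
  · filter_upwards [hcont.eventually hf] with t ht
    have := ht.hasFDerivAt.comp_hasDerivAt t (hline t)
    simp only [InnerProductSpace.toDual_apply_apply, real_inner_comm] at this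
    exact this
  · have h0 : HasFDerivAt G D (y + (0 : ℝ) • ξ) := by simpa using hG
    have := (innerSL ℝ ξ).hasFDerivAt.comp_hasDerivAt (0 : ℝ) (h0.comp_hasDerivAt 0 (hline 0))
    simpa using! this

theorem graphOperator_nonneg {p : E2} {D : E2 →L[ℝ] E2} (hp : ‖p‖ ≤ 1)
    (hD : ∀ ξ, 0 ≤ inner ℝ ξ (D ξ)) : 0 ≤ graphOperator p D := by
  have h0 := hD (EuclideanSpace.single 0 1)
  have h1 := hD (EuclideanSpace.single 1 1)
  simp only [EuclideanSpace.inner_single_left, map_one, one_mul] at h0 h1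
  have : ‖p‖ ^ 2 ≤ 1 := pow_le_one₀ (norm_nonneg _) hp
  exact add_nonneg (mul_nonneg (by linarith) (add_nonneg h0 h1)) (hD p)

/-- On `Ω` the function `w` has gradient `v` and Hessian `Q`, and the value of the graph operator
with slope `P` on the Hessian is controlled by the gradient. -/
structure IsGradientControlled (Ω : Set E2) (w : E2 → ℝ) (v P : E2 → E2) (Q : E2 → E2 →L[ℝ] E2)
    (C : ℝ) : Prop where
  gradient : ∀ y ∈ Ω, HasGradientAt w (v y) y
  hessian : ∀ y ∈ Ω, HasFDerivAt v (Q y) y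
  slope : ∀ y ∈ Ω, ‖P y‖ ≤ 1 / 2
  bound : ∀ y ∈ Ω, |graphOperator (P y) (Q y)| ≤ C * ‖v y‖

variable {Ω : Set E2} {w : E2 → ℝ} {v P : E2 → E2} {Q : E2 → E2 →L[ℝ] E2} {C : ℝ}

theorem IsGradientControlled.mono (hw : IsGradientControlled Ω w v P Q C) {Ω' : Set E2}
    (h : Ω' ⊆ Ω) : IsGradientControlled Ω' w v P Q C :=
  ⟨fun y hy => hw.gradient y (h hy), fun y hy => hw.hessian y (h hy),
    fun y hy => hw.slope y (h hy), fun y hy => hw.bound y (h hy)⟩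

theorem IsGradientControlled.continuousOn (hw : IsGradientControlled Ω w v P Q C) :
    ContinuousOn w Ω :=
  fun y hy => (hw.gradient y hy).hasFDerivAt.continuousAt.continuousWithinAt

/-- The Gaussian barrier around `c`. -/
noncomputable def barrier (α : ℝ) (c y : E2) : ℝ := Real.exp (-α * ‖y - c‖ ^ 2)

theorem barrier_pos (α : ℝ) (c y : E2) : 0 < barrier α c y := Real.exp_pos _

theorem hasGradientAt_barrier (α : ℝ) (c y : E2) :
    HasGradientAt (barrier α c) ((-2 * α * barrier α c y) • (y - c)) y := by
  have h1 : HasFDerivAt (fun y : E2 => ‖y - c‖ ^ 2) (2 • innerSL ℝ (y - c)) y := by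
    simpa using ((hasFDerivAt_id y).sub_const c).norm_sq
  have h2 := (h1.const_mul (-α)).exp
  rw [hasGradientAt_iff_hasFDerivAt]
  refine h2.congr_fderiv ?_
  ext ξ
  simp [barrier]
  ring

theorem hasFDerivAt_gradient_barrier (α : ℝ) (c y : E2) :
    HasFDerivAt (fun y => (-2 * α * barrier α c y) • (y - c))
      ((-2 * α * barrier α c y) • (ContinuousLinearMap.id ℝ E2 -
        (2 * α) • (innerSL ℝ (y - c)).smulRight (y - c))) y := by
  have h1 := ((hasGradientAt_barrier α c y).hasFDerivAt.const_mul (-2 * α)).smul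
    ((hasFDerivAt_id y).sub_const c)
  refine h1.congr_fderiv ?_
  ext ξ i
  simp
  ring

/-- An interior minimum of `w - m * barrier` is impossible in the annulus where the barrier is a
strict subsolution. -/
theorem IsGradientControlled.not_isLocalMin_sub_barrier (hΩ : IsOpen Ω)
    (hw : IsGradientControlled Ω w v P Q C) {y c : E2} (hy : y ∈ Ω) {m α : ℝ} (hm : 0 < m)
    (hα : 0 < α) (hbar : 3 + C * ‖y - c‖ ≤ 3 / 2 * (α * ‖y - c‖ ^ 2)) :
    ¬ IsLocalMin (fun y => w y - m * barrier α c y) y := by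
  intro hmin
  set b := barrier α c y with hb
  have hb0 : 0 < b := barrier_pos α c y
  have hgrad : ∀ y' ∈ Ω, HasGradientAt (fun y => w y - m * barrier α c y)
      (v y' - m • ((-2 * α * barrier α c y') • (y' - c))) y' := by
    intro y' hy'
    have := (hw.gradient y' hy').hasFDerivAt.sub
      ((hasGradientAt_barrier α c y').hasFDerivAt.const_mul m)
    rw [hasGradientAt_iff_hasFDerivAt]
    refine this.congr_fderiv ?_
    simp
  have hess := (hw.hessian y hy).sub ((hasFDerivAt_gradient_barrier α c y).const_smul m)
  have hpos := inner_hessian_nonneg_of_isLocalMin hmin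
    (Filter.eventually_of_mem (hΩ.mem_nhds hy) hgrad) hess
  -- At a critical point `∇w` is `m` times the gradient of the barrier, so the first-order bound on
  -- `w` turns into a bound in terms of the barrier alone.
  have hzero : v y = m • ((-2 * α * b) • (y - c)) := by
    have := hmin.hasFDerivAt_eq_zero (hgrad y hy).hasFDerivAt
    rw [LinearIsometryEquiv.map_eq_zero_iff] at this
    exact sub_eq_zero.1 this
  have hP := hw.slope y hy
  have hop := graphOperator_nonneg (hP.trans (by norm_num)) hpos
  have hP2 : ‖P y‖ ^ 2 ≤ 1 / 4 := by nlinarith [norm_nonneg (P y)]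
  have hnorm : ‖y - c‖ ^ 2 = (y 0 - c 0) ^ 2 + (y 1 - c 1) ^ 2 := by
    simp [EuclideanSpace.norm_sq_eq, Fin.sum_univ_two]
  have hexp : graphOperator (P y) (Q y - m • ((-2 * α * b) • (ContinuousLinearMap.id ℝ E2 -
        (2 * α) • (innerSL ℝ (y - c)).smulRight (y - c)))) =
      graphOperator (P y) (Q y) + 2 * α * m * b * ((1 - ‖P y‖ ^ 2) * (2 - 2 * α * ‖y - c‖ ^ 2)
        + ‖P y‖ ^ 2 - 2 * α * inner ℝ (y - c) (P y) ^ 2) := by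
    rw [hnorm]
    simp only [graphOperator, planeTrace, sub_apply, inner_sub_right,
      inner_smul_right, smul_apply, ContinuousLinearMap.id_apply,
      ContinuousLinearMap.smulRight_apply, innerSL_apply_apply, real_inner_self_eq_norm_sq,
      real_inner_comm (y - c) (P y)]
    simp [EuclideanSpace.inner_single_right]
    ring
  rw [← hb, hexp] at hop
  have hbd := (le_abs_self _).trans (hw.bound y hy)
  have hv : ‖v y‖ = 2 * α * m * b * ‖y - c‖ := by
    rw [hzero, norm_smul, norm_smul, Real.norm_eq_abs, Real.norm_eq_abs, abs_of_pos hm,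
      abs_of_neg (by nlinarith [mul_pos hα hb0])]
    ring
  rw [hv] at hbd
  have hk : 0 < 2 * α * m * b := by positivity
  have h1 : 0 ≤ 2 * α * m * b * (C * ‖y - c‖ + ((1 - ‖P y‖ ^ 2) * (2 - 2 * α * ‖y - c‖ ^ 2)
        + ‖P y‖ ^ 2 - 2 * α * inner ℝ (y - c) (P y) ^ 2)) := by linarith
  have h2 := nonneg_of_mul_nonneg_right h1 hk
  have h3 : 0 ≤ 2 * α * inner ℝ (y - c) (P y) ^ 2 := by positivity
  -- Ellipticity: `‖P y‖ ≤ 1/2` leaves at least `3/4` of the term `2α‖y - c‖²`. By `hbar` this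
  -- outweighs `C‖y - c‖` and the remaining terms, which are at most `2`.
  have h4 : 3 / 4 * (2 * α * ‖y - c‖ ^ 2) ≤ (1 - ‖P y‖ ^ 2) * (2 * α * ‖y - c‖ ^ 2) :=
    mul_le_mul_of_nonneg_right (by linarith) (by positivity)
  nlinarith [sq_nonneg ‖P y‖]

/-- Hopf's boundary point lemma. -/
theorem IsGradientControlled.hopf {c z : E2} {R : ℝ} (hR : 0 < R)
    (hw : IsGradientControlled (Metric.ball c R) w v P Q C) (hC : 0 ≤ C)
    (hpos : ∀ y ∈ Metric.ball c R, 0 < w y) (hz : dist z c = R) :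
    ∃ ε > 0, ∀ t : ℝ, 0 < t → t < 1 / 2 → ε * t ≤ w (z + t • (c - z)) := by
  obtain ⟨y₁, hy₁, hmin⟩ := (isCompact_closedBall c (R / 2)).exists_isMinOn
    ⟨c, Metric.mem_closedBall_self (by positivity)⟩
    (hw.continuousOn.mono (Metric.closedBall_subset_ball (by linarith)))
  set m := w y₁ with hm
  have hm0 : 0 < m := hpos _ (Metric.closedBall_subset_ball (by linarith) hy₁)
  -- For `‖y - c‖ ≥ R/2` this gives `α‖y - c‖² ≥ 2 + C R`, enough for the hypothesis `hbar` of
  -- `not_isLocalMin_sub_barrier`.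
  set α := (8 + 4 * C * R) / R ^ 2 with hα
  have hα0 : 0 < α := by positivity
  have hαR : α * R ^ 2 = 8 + 4 * C * R := by rw [hα]; field_simp
  -- Comparison on the annulus between radii `R/2` and `R'`. Nothing is known about `w` on the
  -- sphere of radius `R`, hence the smaller `R'`, which tends to `R` afterwards. On the inner
  -- circle `w ≥ m` and the barrier is at most `1`; on the outer one `w > 0`.
  have key : ∀ R' < R, ∀ y, R / 2 ≤ ‖y - c‖ → ‖y - c‖ ≤ R' →
      m * (barrier α c y - Real.exp (-α * R' ^ 2)) ≤ w y := by
    intro R' hR' y hy hy'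
    have hcomp : IsCompact (Metric.closedBall c R' ∩ {y | R / 2 ≤ ‖y - c‖}) :=
      (isCompact_closedBall c R').inter_right
        (isClosed_le continuous_const (continuous_id.sub continuous_const).norm)
    have hsub : Metric.closedBall c R' ⊆ Metric.ball c R := Metric.closedBall_subset_ball hR'
    have hbc : Continuous (barrier α c) := by unfold barrier; fun_prop
    obtain ⟨y₀, ⟨hy₀, hy₀'⟩, hmin₀⟩ := hcomp.exists_isMinOn
      (f := fun y => w y - m * barrier α c y) ⟨y, by simpa [dist_eq_norm] using hy', hy⟩
      ((hw.continuousOn.mono (Set.inter_subset_left.trans hsub)).sub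
        (continuous_const.mul hbc).continuousOn)
    have hle : w y₀ - m * barrier α c y₀ ≤ w y - m * barrier α c y :=
      hmin₀ ⟨by simpa [dist_eq_norm] using hy', hy⟩
    have hy₀n : ‖y₀ - c‖ ≤ R' := by simpa [dist_eq_norm] using hy₀
    have hexp : 0 < Real.exp (-α * R' ^ 2) := Real.exp_pos _
    suffices h : -(m * Real.exp (-α * R' ^ 2)) ≤ w y₀ - m * barrier α c y₀ by linarith
    simp only [Set.mem_ofPred_eq] at hy₀'
    rcases eq_or_lt_of_le hy₀' with h1 | h1
    · have h2 : m ≤ w y₀ := hmin (by simp [dist_eq_norm, ← h1])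
      have h3 : barrier α c y₀ ≤ 1 := Real.exp_le_one_iff.2 (by nlinarith [sq_nonneg ‖y₀ - c‖])
      nlinarith
    rcases eq_or_lt_of_le hy₀n with h2 | h2
    · have := hpos _ (hsub hy₀)
      rw [barrier, h2]
      linarith
    exfalso
    refine hw.not_isLocalMin_sub_barrier Metric.isOpen_ball (hsub hy₀) hm0 hα0 ?_
      (hmin₀.isLocalMin ?_) (c := c)
    · have h5 : ‖y₀ - c‖ < R := h2.trans hR'
      have h6 : C * ‖y₀ - c‖ ≤ C * R := mul_le_mul_of_nonneg_left h5.le hC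
      have h7 : α * (R / 2) ^ 2 ≤ α * ‖y₀ - c‖ ^ 2 := by gcongr
      nlinarith [mul_nonneg hC hR.le]
    · have o1 : IsOpen {y : E2 | ‖y - c‖ < R'} :=
        isOpen_lt (continuous_id.sub continuous_const).norm continuous_const
      have o2 : IsOpen {y : E2 | R / 2 < ‖y - c‖} :=
        isOpen_lt continuous_const (continuous_id.sub continuous_const).norm
      filter_upwards [o1.mem_nhds h2, o2.mem_nhds h1] with y h3 h4
      exact ⟨by simpa [dist_eq_norm] using h3.le, h4.le⟩
  have key' : ∀ y, R / 2 ≤ ‖y - c‖ → ‖y - c‖ < R →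
      m * (barrier α c y - Real.exp (-α * R ^ 2)) ≤ w y := by
    intro y h1 h2
    have hlim : Filter.Tendsto (fun R' => m * (barrier α c y - Real.exp (-α * R' ^ 2)))
        (𝓝[<] R) (𝓝 (m * (barrier α c y - Real.exp (-α * R ^ 2)))) :=
      (Continuous.tendsto (by fun_prop) R).mono_left nhdsWithin_le_nhds
    refine le_of_tendsto hlim ?_
    filter_upwards [Ioo_mem_nhdsLT h2] with R' hR'
    exact key R' hR'.2 y h1 hR'.1.le
  -- This slope comes from `exp s ≥ 1 + s` applied to the growth of the barrier along the radius,
  -- with `2t - t² ≥ t`.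
  refine ⟨m * (Real.exp (-α * R ^ 2) * (α * R ^ 2)), by positivity, fun t ht0 ht1 => ?_⟩
  have hn : ‖z + t • (c - z) - c‖ = (1 - t) * R := by
    rw [show z + t • (c - z) - c = (1 - t) • (z - c) by module, norm_smul, ← dist_eq_norm z, hz,
      Real.norm_eq_abs, abs_of_pos (by linarith)]
  refine le_trans ?_ (key' _ (by rw [hn]; nlinarith) (by rw [hn]; nlinarith))
  rw [mul_assoc]
  refine mul_le_mul_of_nonneg_left ?_ hm0.le
  rw [barrier, hn, show -α * ((1 - t) * R) ^ 2 = -α * R ^ 2 + α * R ^ 2 * (2 * t - t ^ 2) by ring,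
    Real.exp_add]
  have h1 := Real.add_one_le_exp (α * R ^ 2 * (2 * t - t ^ 2))
  have h2 : α * R ^ 2 * t ≤ α * R ^ 2 * (2 * t - t ^ 2) :=
    mul_le_mul_of_nonneg_left (by nlinarith) (by positivity)
  nlinarith [Real.exp_pos (-α * R ^ 2)]

/-- Interior touching: a nonnegative controlled function vanishing at a point vanishes nearby. -/
theorem IsGradientControlled.eventually_eq_zero (hΩ : IsOpen Ω)
    (hw : IsGradientControlled Ω w v P Q C) (hC : 0 ≤ C) (hnn : ∀ y ∈ Ω, 0 ≤ w y) {y : E2}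
    (hy : y ∈ Ω) (h0 : w y = 0) : ∀ᶠ y' in 𝓝 y, w y' = 0 := by
  obtain ⟨r, hr, hball⟩ := Metric.isOpen_iff.1 hΩ y hy
  refine Filter.eventually_of_mem (Metric.ball_mem_nhds y (half_pos (half_pos hr))) fun c hc => ?_
  by_contra hne
  have hsub : Metric.closedBall y (r / 2) ⊆ Ω :=
    (Metric.closedBall_subset_ball (by linarith)).trans hball
  set Z := Metric.closedBall y (r / 2) ∩ w ⁻¹' {0} with hZ
  have hZc : IsCompact Z := (isCompact_closedBall y (r / 2)).of_isClosed_subset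
    ((hw.continuousOn.mono hsub).preimage_isClosed_of_isClosed Metric.isClosed_closedBall
      isClosed_singleton) Set.inter_subset_left
  have hyZ : y ∈ Z := ⟨Metric.mem_closedBall_self (by positivity), h0⟩
  -- The ball around `c` reaching to the nearest zero `z` contains no zero. Since `c` is within
  -- `r/4` of the zero `y`, this ball stays in the closed ball of radius `r/2`. Hopf's lemma at `z`
  -- contradicts the vanishing derivative at the interior minimum `z`.
  obtain ⟨z, hzZ, hz⟩ := hZc.exists_infDist_eq_dist ⟨y, hyZ⟩ c
  have hmin : ∀ z' ∈ Z, dist c z ≤ dist c z' := fun z' hz' => hz ▸ Metric.infDist_le_dist_of_mem hz'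
  rw [Metric.mem_ball] at hc
  have hlt : dist c z < r / 2 / 2 := (hmin y hyZ).trans_lt hc
  have hR : 0 < dist c z := dist_pos.2 fun h => hne (h ▸ hzZ.2)
  have hsub' : Metric.ball c (dist c z) ⊆ Metric.closedBall y (r / 2) := by
    intro y' hy'
    rw [Metric.mem_ball] at hy'
    rw [Metric.mem_closedBall]
    linarith [dist_triangle y' c y]
  have hpos : ∀ y' ∈ Metric.ball c (dist c z), 0 < w y' := by
    intro y' hy'
    refine lt_of_le_of_ne (hnn _ (hsub (hsub' hy'))) fun h => ?_
    have := hmin y' ⟨hsub' hy', h.symm⟩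
    rw [Metric.mem_ball, dist_comm] at hy'
    linarith
  obtain ⟨ε, hε, hopf⟩ := (hw.mono (hsub'.trans hsub)).hopf hR hC hpos (dist_comm z c)
  have hzΩ := hsub hzZ.1
  have hzmin : IsLocalMin w z := by
    filter_upwards [hΩ.mem_nhds hzΩ] with y' hy'
    rw [show w z = 0 from hzZ.2]
    exact hnn y' hy'
  have hder : HasFDerivAt w (0 : E2 →L[ℝ] ℝ) z := by
    have h := (hw.gradient z hzΩ).hasFDerivAt
    rwa [hzmin.hasFDerivAt_eq_zero h] at h
  have hline : HasDerivAt (fun t : ℝ => w (z + t • (c - z))) 0 0 := by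
    have h1 : HasDerivAt (fun t : ℝ => z + t • (c - z)) (c - z) 0 := by
      simpa using ((hasDerivAt_id (0 : ℝ)).smul_const (c - z)).const_add z
    have h2 : HasFDerivAt w (0 : E2 →L[ℝ] ℝ) (z + (0 : ℝ) • (c - z)) := by simpa using hder
    simpa using! h2.comp_hasDerivAt 0 h1
  have hslope := hline.tendsto_slope_zero_right
  have : ε ≤ 0 := by
    refine ge_of_tendsto hslope ?_
    filter_upwards [Ioo_mem_nhdsGT (show (0 : ℝ) < 1 / 2 by norm_num)] with t ht
    have := hopf t ht.1 ht.2
    simp only [zero_add, zero_smul, add_zero, show w z = 0 from hzZ.2, sub_zero, smul_eq_mul]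
    rw [inv_mul_eq_div, le_div_iff₀ ht.1]
    exact this
  linarith

/-- The strong maximum principle. -/
theorem IsGradientControlled.eqOn_zero (hΩ : IsOpen Ω)
    (hw : IsGradientControlled Ω w v P Q C) (hC : 0 ≤ C) (hnn : ∀ y ∈ Ω, 0 ≤ w y) {S : Set E2}
    (hS : IsPreconnected S) (hSΩ : S ⊆ Ω) {y : E2} (hy : y ∈ S) (h0 : w y = 0) :
    ∀ y' ∈ S, w y' = 0 := by
  set U := {y | y ∈ Ω ∧ w y = 0} with hU
  have hUo : IsOpen U := by
    rw [isOpen_iff_mem_nhds]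
    intro y hy
    filter_upwards [hΩ.mem_nhds hy.1, hw.eventually_eq_zero hΩ hC hnn hy.1 hy.2] with y' h1 h2
      using ⟨h1, h2⟩
  have hVo : IsOpen (Ω ∩ w ⁻¹' {0}ᶜ) :=
    hw.continuousOn.isOpen_inter_preimage hΩ isOpen_compl_singleton
  have hcov : S ⊆ U ∪ (Ω ∩ w ⁻¹' {0}ᶜ) := by
    intro y' hy'
    by_cases h : w y' = 0
    · exact Or.inl ⟨hSΩ hy', h⟩
    · exact Or.inr ⟨hSΩ hy', h⟩
  have hdisj : Disjoint U (Ω ∩ w ⁻¹' {0}ᶜ) :=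
    Set.disjoint_left.2 fun y' h1 h2 => h2.2 h1.2
  have := hS.subset_left_of_subset_union hUo hVo hdisj hcov ⟨y, hy, hSΩ hy, h0⟩
  exact fun y' hy' => (this hy').2

end LorentzMinkowski

namespace LorentzMinkowski

/-! ### Charts modelled on the half-plane -/

section Chart

variable {M : Type*} [TopologicalSpace M] [ChartedSpace (EuclideanHalfSpace 2) M]

/-- The closed half-plane. -/
def halfPlane : Set E2 := {z | 0 ≤ z 0}

theorem convex_halfPlane : Convex ℝ halfPlane :=
  convex_halfSpace_ge (f := fun z : E2 => z 0) ⟨fun _ _ => rfl, fun _ _ => rfl⟩ 0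

theorem range_halfPlane : Set.range (𝓡∂ 2) = halfPlane := by
  rw [range_modelWithCornersEuclideanHalfSpace]; rfl

theorem halfPlane_mem_nhds {z : E2} (hz : 0 < z 0) : halfPlane ∈ 𝓝 z :=
  Filter.mem_of_superset
    ((isOpen_lt continuous_const (by fun_prop : Continuous fun z : E2 => z 0)).mem_nhds hz)
    fun z (h : 0 < z 0) => h.le

theorem uniqueDiffOn_halfPlane : UniqueDiffOn ℝ halfPlane :=
  uniqueDiffOn_convex convex_halfPlane ⟨EuclideanSpace.single 0 1, by
    rw [mem_interior_iff_mem_nhds]; exact halfPlane_mem_nhds (by simp)⟩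

theorem contDiffWithinAt_chart {f : M → E3} (hf : ContMDiff (𝓡∂ 2) 𝓘(ℝ, E3) ∞ f) (q : M) :
    ContDiffWithinAt ℝ ∞ (f ∘ (extChartAt (𝓡∂ 2) q).symm) halfPlane (extChartAt (𝓡∂ 2) q q) := by
  have := (contMDiffAt_iff.1 (hf q)).2
  rw [range_halfPlane] at this
  simpa using! this

theorem hasFDerivWithinAt_chart {f : M → E3} (hf : ContMDiff (𝓡∂ 2) 𝓘(ℝ, E3) ∞ f) (q : M) :
    HasFDerivWithinAt (f ∘ (extChartAt (𝓡∂ 2) q).symm) (differential f q) halfPlane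
      (extChartAt (𝓡∂ 2) q q) := by
  have := ((hf q).mdifferentiableAt (by simp)).hasMFDerivAt.2
  rw [range_halfPlane] at this
  simpa using! this

/-- `differential` at a nearby point is read in that point's own preferred chart, so the fixed chart
at `q` introduces a transition `L`. It is the same for every `f`, so position and normal can be
reparametrized together. -/
theorem exists_hasFDerivAt_chart [IsManifold (𝓡∂ 2) ∞ M] (q : M) {z : E2}
    (hz : z ∈ (extChartAt (𝓡∂ 2) q).target) (hz0 : 0 < z 0) :
    ∃ L : E2 ≃L[ℝ] E2, ∀ f : M → E3, ContMDiff (𝓡∂ 2) 𝓘(ℝ, E3) ∞ f →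
      HasFDerivAt (f ∘ (extChartAt (𝓡∂ 2) q).symm)
        (differential f ((extChartAt (𝓡∂ 2) q).symm z) ∘L (L : E2 →L[ℝ] E2)) z := by
  have : IsManifold (𝓡∂ 2) 1 M := IsManifold.of_le (n := ∞) (by simp)
  obtain ⟨L, hL⟩ := isInvertible_mfderivWithin_extChartAt_symm hz
  refine ⟨L, fun f hf => ?_⟩
  have h1 := (mdifferentiableWithinAt_extChartAt_symm hz).hasMFDerivWithinAt
  have h2 := ((hf ((extChartAt (𝓡∂ 2) q).symm z)).mdifferentiableAt (by simp)).hasMFDerivAt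
  have h3 := (h2.comp_hasMFDerivWithinAt z h1).hasFDerivWithinAt
  rw [← hL, range_halfPlane] at h3
  exact h3.hasFDerivAt (halfPlane_mem_nhds hz0)

theorem eventually_chart_symm_mem {q : M} {V : Set M} (hV : V ∈ 𝓝 q) :
    ∀ᶠ z in 𝓝[halfPlane] (extChartAt (𝓡∂ 2) q q),
      z ∈ (extChartAt (𝓡∂ 2) q).target ∧ (extChartAt (𝓡∂ 2) q).symm z ∈ V := by
  rw [← range_halfPlane]
  refine Filter.Eventually.and (extChartAt_target_mem_nhdsWithin q) ?_
  have := map_extChartAt_symm_nhdsWithin_range (I := 𝓡∂ 2) q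
  rw [← this] at hV
  exact hV

end Chart

/-! ### Extending a map of the half-plane to a homeomorphism of the plane -/

/-- The coordinatewise projection to a box. -/
noncomputable def clamp (lo hi z : E2) : E2 := WithLp.toLp 2 fun i => max (lo i) (min (z i) (hi i))

theorem norm_le_norm_of_abs_le {u v : E2} (h : ∀ i, |u i| ≤ |v i|) : ‖u‖ ≤ ‖v‖ := by
  rw [EuclideanSpace.norm_eq, EuclideanSpace.norm_eq]
  refine Real.sqrt_le_sqrt (Finset.sum_le_sum fun i _ => ?_)
  exact pow_le_pow_left₀ (norm_nonneg _) (h i) 2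

theorem norm_clamp_sub_clamp_le (lo hi z z' : E2) :
    ‖clamp lo hi z - clamp lo hi z'‖ ≤ ‖z - z'‖ := by
  refine norm_le_norm_of_abs_le fun i => ?_
  simp only [clamp, PiLp.sub_apply]
  refine (abs_max_sub_max_le_max _ _ _ _).trans ?_
  rw [sub_self, abs_zero]
  refine max_le (abs_nonneg _) ((abs_min_sub_min_le_max _ _ _ _).trans ?_)
  simp

theorem clamp_eq_self {lo hi z : E2} (h : ∀ i, lo i ≤ z i ∧ z i ≤ hi i) : clamp lo hi z = z := by
  ext i
  simp [clamp, (h i).1, (h i).2]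

theorem abs_apply_le_norm (v : E2) (i : Fin 2) : |v i| ≤ ‖v‖ := PiLp.norm_apply_le v i

/-- An inverse function theorem at a boundary point. On a small box in the half-plane, `F` is the
affine map `A (z - z₀)` plus a remainder `E` with small Lipschitz constant. Replacing `E z` by `E
(clamp z)` extends it to the plane without increasing that constant, and a small Lipschitz
perturbation of an isomorphism is a homeomorphism. The last two estimates control the shape of the
image of the half-plane. -/
theorem exists_homeomorph_extension_halfPlane {F : E2 → E2} {z₀ : E2} (hz₀ : z₀ ∈ halfPlane)
    (hF : ContDiffWithinAt ℝ 2 F halfPlane z₀) (hF₀ : F z₀ = 0) {A : E2 ≃L[ℝ] E2}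
    (hA : HasFDerivWithinAt F (A : E2 →L[ℝ] E2) halfPlane z₀) {s₀ : Set E2}
    (hs₀ : s₀ ∈ 𝓝[halfPlane] z₀) {η : ℝ} (hη : 0 < η) :
    ∃ Φ : E2 ≃ₜ E2, ∃ r > 0, ∃ K > 0,
      (∀ z ∈ halfPlane, dist z z₀ < r → z ∈ s₀ ∧ Φ z = F z) ∧ Φ.symm 0 = z₀ ∧
      (∀ y y', ‖Φ.symm y - Φ.symm y'‖ ≤ K * ‖y - y'‖) ∧
      (∀ y y', ‖Φ.symm y - Φ.symm y' - A.symm (y - y')‖ ≤ η * ‖y - y'‖) ∧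
      ∀ y, ‖Φ.symm y - z₀ - A.symm y‖ ≤ K * ‖y‖ ^ 2 := by
  -- the derivative is Lipschitz near `z₀`
  obtain ⟨k, t, ht, hk⟩ := (hF.fderivWithin_right uniqueDiffOn_halfPlane (m := 1)
    (by norm_num) hz₀).exists_lipschitzOnWith convex_halfPlane
  have hdiff : ∀ᶠ z in 𝓝[halfPlane] z₀, DifferentiableWithinAt ℝ F halfPlane z := by
    have := hF.eventually (by simp)
    rw [Set.insert_eq_of_mem hz₀] at this
    exact this.mono fun z hz => hz.differentiableWithinAt (by simp)
  obtain ⟨r₀, hr₀, hball⟩ := Metric.mem_nhdsWithin_iff.1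
    (Filter.inter_mem ht (Filter.inter_mem hdiff hs₀))
  set n : ℝ := ‖(A.symm : E2 →L[ℝ] E2)‖ with hn
  have hn0 : 0 < n := A.norm_symm_pos
  have hAn : ∀ v, ‖A.symm v‖ ≤ n * ‖v‖ := (A.symm : E2 →L[ℝ] E2).le_opNorm
  -- The bound `2nc ≤ 1` makes the inverse `2n`-Lipschitz; then `2n²c ≤ η` bounds its deviation from
  -- `A.symm`.
  obtain ⟨c, hc0, hc1, hc2⟩ : ∃ c > 0, 2 * n * c ≤ 1 ∧ 2 * n ^ 2 * c ≤ η := by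
    refine ⟨min (1 / (2 * n)) (η / (2 * n ^ 2)), by positivity, ?_, ?_⟩
    · refine (mul_le_mul_of_nonneg_left (min_le_left _ _) (by positivity)).trans ?_
      field_simp; rfl
    · refine (mul_le_mul_of_nonneg_left (min_le_right _ _) (by positivity)).trans ?_
      field_simp; rfl
  obtain ⟨r, hr, hrr, hrc⟩ : ∃ r > 0, 2 * r ≤ r₀ ∧ k * (2 * r) ≤ c := by
    refine ⟨min (r₀ / 2) (c / (2 * (k + 1))), by positivity, ?_, ?_⟩
    · linarith [min_le_left (r₀ / 2) (c / (2 * ((k : ℝ) + 1)))]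
    · have h1 := min_le_right (r₀ / 2) (c / (2 * ((k : ℝ) + 1)))
      rw [le_div_iff₀ (by positivity)] at h1
      have : 0 < min (r₀ / 2) (c / (2 * ((k : ℝ) + 1))) := by positivity
      nlinarith
  -- the box
  set lo : E2 := WithLp.toLp 2 ![max 0 (z₀ 0 - r), z₀ 1 - r] with hlo
  set hi : E2 := WithLp.toLp 2 ![z₀ 0 + r, z₀ 1 + r] with hhi
  have hz₀' : 0 ≤ z₀ 0 := hz₀
  have hlohi : ∀ i, lo i ≤ z₀ i ∧ z₀ i ≤ hi i := by
    intro i; fin_cases i <;> simp [hlo, hhi, hz₀', hr.le]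
  set s := {z : E2 | ∀ i, lo i ≤ z i ∧ z i ≤ hi i} with hs
  have hsH : s ⊆ halfPlane := fun z hz => by
    have := (hz 0).1
    simp only [hlo, Matrix.cons_val_zero] at this
    exact (le_max_left _ _).trans this
  have hsr : ∀ z ∈ s, ‖z - z₀‖ < 2 * r := by
    intro z hz
    have h0 := hz 0
    have h1 := hz 1
    simp only [hlo, hhi, Matrix.cons_val_zero, Matrix.cons_val_one, max_le_iff] at h0 h1
    have h : ‖z - z₀‖ ^ 2 ≤ 2 * r ^ 2 := by
      rw [EuclideanSpace.norm_sq_eq, Fin.sum_univ_two]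
      simp only [PiLp.sub_apply, Real.norm_eq_abs, sq_abs]
      nlinarith
    refine lt_of_pow_lt_pow_left₀ 2 (by positivity) (h.trans_lt (by nlinarith))
  have hsball : ∀ z ∈ s, z ∈ t ∧ DifferentiableWithinAt ℝ F halfPlane z ∧ z ∈ s₀ := fun z hz =>
    hball ⟨by rw [Metric.mem_ball, dist_eq_norm]; exact (hsr z hz).trans_le hrr, hsH hz⟩
  have hzs : z₀ ∈ s := hlohi
  have hsconv : Convex ℝ s := by
    intro z hz z' hz' a b ha hb hab i
    change lo i ≤ a * z i + b * z' i ∧ a * z i + b * z' i ≤ hi i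
    obtain ⟨h1, h2⟩ := hz i
    obtain ⟨h3, h4⟩ := hz' i
    have ha' : a = 1 - b := by linarith
    subst ha'
    constructor <;> nlinarith
  have hfA : fderivWithin ℝ F halfPlane z₀ = A := hA.fderivWithin (uniqueDiffOn_halfPlane z₀ hz₀)
  have hbound : ∀ z ∈ s, ‖fderivWithin ℝ F halfPlane z - A‖ ≤ k * ‖z - z₀‖ := by
    intro z hz
    rw [← hfA]
    exact hk.norm_sub_le (hsball z hz).1 (hsball z₀ hzs).1
  -- the remainder
  set E : E2 → E2 := fun z => F z - A (z - z₀) with hE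
  have hE₀ : E z₀ = 0 := by simp [hE, hF₀]
  have hElip : ∀ z ∈ s, ∀ z' ∈ s, ‖E z - E z'‖ ≤ c * ‖z - z'‖ := by
    intro z hz z' hz'
    have := hsconv.norm_image_sub_le_of_norm_hasFDerivWithin_le'
      (fun z hz => ((hsball z hz).2.1.hasFDerivWithinAt.mono hsH))
      (fun z hz => (hbound z hz).trans ((mul_le_mul_of_nonneg_left (hsr z hz).le k.2).trans hrc))
      hz' hz
    have heq : E z - E z' = F z - F z' - (A : E2 →L[ℝ] E2) (z - z') := by
      simp only [E, ContinuousLinearEquiv.coe_coe, map_sub]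
      abel
    rwa [heq]
  -- Intersecting with the ball of radius `‖z - z₀‖` bounds the derivative of `E` by `k‖z - z₀‖`
  -- along the way, which makes the remainder quadratic.
  have hEsq : ∀ z ∈ s, ‖E z‖ ≤ k * ‖z - z₀‖ ^ 2 := by
    intro z hz
    have hsub : s ∩ Metric.closedBall z₀ ‖z - z₀‖ ⊆ s := Set.inter_subset_left
    have := (hsconv.inter (convex_closedBall z₀ ‖z - z₀‖)).norm_image_sub_le_of_norm_hasFDerivWithin_le'
      (fun z hz => ((hsball z hz.1).2.1.hasFDerivWithinAt.mono (hsub.trans hsH)))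
      (fun z' hz' => (hbound z' hz'.1).trans (mul_le_mul_of_nonneg_left
        (by simpa [dist_eq_norm] using hz'.2) k.2))
      ⟨hzs, Metric.mem_closedBall_self (norm_nonneg _)⟩ ⟨hz, by simp [dist_eq_norm]⟩
    calc ‖E z‖ = ‖F z - F z₀ - (A : E2 →L[ℝ] E2) (z - z₀)‖ := by simp [hE, hF₀]
      _ ≤ k * ‖z - z₀‖ * ‖z - z₀‖ := this
      _ = _ := by ring
  have hcl : ∀ z, clamp lo hi z ∈ s := fun z i => by
    exact ⟨le_max_left _ _, max_le ((hlohi i).1.trans (hlohi i).2) (min_le_right _ _)⟩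
  have hclz₀ : clamp lo hi z₀ = z₀ := clamp_eq_self hlohi
  set f : E2 → E2 := fun z => A (z - z₀) + E (clamp lo hi z) with hf
  have hflin : ∀ z z', ‖f z - f z' - A (z - z')‖ ≤ c * ‖z - z'‖ := by
    intro z z'
    have h1 : f z - f z' - A (z - z') = E (clamp lo hi z) - E (clamp lo hi z') := by
      simp only [hf, map_sub]; abel
    rw [h1]
    exact (hElip _ (hcl z) _ (hcl z')).trans
      (mul_le_mul_of_nonneg_left (norm_clamp_sub_clamp_le _ _ _ _) hc0.le)
  have happ : ApproximatesLinearOn f (A : E2 →L[ℝ] E2) Set.univ c.toNNReal := by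
    intro z _ z' _
    rw [Real.coe_toNNReal c hc0.le]
    exact hflin z z'
  have hcn : c.toNNReal < ‖(A.symm : E2 →L[ℝ] E2)‖₊⁻¹ := by
    rw [← NNReal.coe_lt_coe, Real.coe_toNNReal c hc0.le, NNReal.coe_inv, coe_nnnorm, ← hn,
      ← one_div, lt_div_iff₀ hn0]
    linarith [mul_pos hn0 hc0]
  set Φ : E2 ≃ₜ E2 := happ.toHomeomorph f (Or.inr hcn) with hΦ
  have hΦf : ∀ z, Φ z = f z := fun z => rfl
  have hinv : ∀ y y', ‖Φ.symm y - Φ.symm y' - A.symm (y - y')‖ ≤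
      n * (c * ‖Φ.symm y - Φ.symm y'‖) := by
    intro y y'
    have h1 := hflin (Φ.symm y) (Φ.symm y')
    rw [← hΦf, ← hΦf, Φ.apply_symm_apply, Φ.apply_symm_apply] at h1
    have h2 : Φ.symm y - Φ.symm y' - A.symm (y - y') =
        -A.symm (y - y' - A (Φ.symm y - Φ.symm y')) := by simp
    rw [h2, norm_neg]
    exact (hAn _).trans (mul_le_mul_of_nonneg_left h1 hn0.le)
  have hlip : ∀ y y', ‖Φ.symm y - Φ.symm y'‖ ≤ 2 * n * ‖y - y'‖ := by
    intro y y'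
    have h1 := norm_sub_le (Φ.symm y - Φ.symm y' - A.symm (y - y')) (-A.symm (y - y'))
    rw [sub_neg_eq_add, sub_add_cancel, norm_neg] at h1
    have h2 := hinv y y'
    have h3 := hAn (y - y')
    nlinarith [norm_nonneg (Φ.symm y - Φ.symm y')]
  have hΦ₀ : Φ.symm 0 = z₀ := by
    rw [Homeomorph.symm_apply_eq, hΦf]
    simp [hf, hclz₀, hE₀]
  refine ⟨Φ, r, hr, max (2 * n) (n * (k * (2 * n) ^ 2)), lt_max_of_lt_left (by positivity), ?_, hΦ₀,
    fun y y' => (hlip y y').trans (mul_le_mul_of_nonneg_right (le_max_left _ _) (norm_nonneg _)),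
    fun y y' => ?_, fun y => ?_⟩
  · intro z hz hzr
    have hz' : z ∈ s := by
      rw [dist_eq_norm] at hzr
      have h0 := abs_lt.1 ((abs_apply_le_norm (z - z₀) 0).trans_lt hzr)
      have h1 := abs_lt.1 ((abs_apply_le_norm (z - z₀) 1).trans_lt hzr)
      simp only [PiLp.sub_apply] at h0 h1
      have hz0 : 0 ≤ z 0 := hz
      intro i
      fin_cases i
      · simp only [hlo, hhi, Fin.zero_eta, Matrix.cons_val_zero]
        exact ⟨max_le hz0 (by linarith), by linarith⟩
      · simp only [hlo, hhi, Fin.mk_one, Matrix.cons_val_one]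
        exact ⟨by simpa using (by linarith : z₀ 1 - r ≤ z 1), by simpa using (by linarith : z 1 ≤ z₀ 1 + r)⟩
    refine ⟨(hsball z hz').2.2, ?_⟩
    rw [hΦf]
    simp [hf, hE, clamp_eq_self hz']
  · refine (hinv y y').trans ?_
    have := mul_le_mul_of_nonneg_left (hlip y y') (mul_pos hn0 hc0).le
    nlinarith [norm_nonneg (y - y')]
  · have h1 : Φ.symm y - z₀ - A.symm y = -A.symm (E (clamp lo hi (Φ.symm y))) := by
      have : y = A (Φ.symm y - z₀) + E (clamp lo hi (Φ.symm y)) := by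
        conv_lhs => rw [← Φ.apply_symm_apply y, hΦf]
      conv_lhs => rw [this]
      simp only [map_add, ContinuousLinearEquiv.symm_apply_apply]
      rw [← this]
      abel
    have h2 : ‖clamp lo hi (Φ.symm y) - z₀‖ ≤ 2 * n * ‖y‖ := by
      have h3 := norm_clamp_sub_clamp_le lo hi (Φ.symm y) z₀
      have h4 := hlip y 0
      rw [hclz₀] at h3
      rw [hΦ₀, sub_zero] at h4
      exact h3.trans h4
    rw [h1, norm_neg]
    calc _ ≤ n * (k * (2 * n * ‖y‖) ^ 2) := by
          refine (hAn _).trans (mul_le_mul_of_nonneg_left ((hEsq _ (hcl _)).trans ?_) hn0.le)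
          gcongr
      _ = n * (k * (2 * n) ^ 2) * ‖y‖ ^ 2 := by ring
      _ ≤ _ := mul_le_mul_of_nonneg_right (le_max_right _ _) (by positivity)

end LorentzMinkowski

namespace LorentzMinkowski

/-! ### Spacelike surfaces as local graphs up to the boundary -/

variable {M : Type*} [TopologicalSpace M] [ChartedSpace (EuclideanHalfSpace 2) M]

/-- Near `q` the surface `x`, seen from `p` in the coordinates `(π, ht)`, is the graph over
`{0 ≤ g}` of the function `u`, whose gradient `ψ` and Hessian `Q` on `{0 < g}` satisfy the equation
of mean curvature `h`. The domain contains a paraboloid with axis `e` and is invariant under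
translation along `e`. -/
structure IsLocalGraph (π : E3 →L[ℝ] E2) (ht : E3 →L[ℝ] ℝ) (x : M → E3) (p : E3) (q : M)
    (V : Set M) (h : ℝ) (e : E2) (ρ K : ℝ) (g u : E2 → ℝ) (ψ : E2 → E2)
    (Q : E2 → E2 →L[ℝ] E2) : Prop where
  continuous_domain : Continuous g
  eventually_mem : ∀ᶠ a in 𝓝 q, 0 ≤ g (π (x a - p)) ∧ u (π (x a - p)) = ht (x a - p)
  exists_eq : ∀ y ∈ Metric.ball (0 : E2) ρ, 0 ≤ g y →
    ∃ a ∈ V, π (x a - p) = y ∧ ht (x a - p) = u y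
  gradient : ∀ y ∈ Metric.ball (0 : E2) ρ, 0 < g y → HasGradientAt u (ψ y) y
  hessian : ∀ y ∈ Metric.ball (0 : E2) ρ, 0 < g y → HasFDerivAt ψ (Q y) y
  slope : ∀ y ∈ Metric.ball (0 : E2) ρ, 0 < g y → ‖ψ y‖ ≤ 1 / 2
  bound : ∀ y ∈ Metric.ball (0 : E2) ρ, 0 < g y → ‖Q y‖ ≤ K
  equation : ∀ y ∈ Metric.ball (0 : E2) ρ, 0 < g y →
    graphOperator (ψ y) (Q y) = 2 * h * Real.sqrt (1 - ‖ψ y‖ ^ 2) ^ 3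
  continuousOn : ContinuousOn u (Metric.ball 0 ρ ∩ {y | 0 ≤ g y})
  isLittleO : ∀ ε > 0, ∃ δ > 0, ∀ y, ‖y‖ < δ → 0 ≤ g y → |u y| ≤ ε * ‖y‖
  paraboloid : ∀ y ∈ Metric.ball (0 : E2) ρ, K * ‖y‖ ^ 2 < inner ℝ e y → 0 < g y
  translate : ∀ y ∈ Metric.ball (0 : E2) ρ, 0 ≤ g y → ∀ t : ℝ, 0 < t →
    y + t • e ∈ Metric.ball (0 : E2) ρ → 0 < g (y + t • e)
  interior : (𝓡∂ 2).IsInteriorPoint q → ∀ y ∈ Metric.ball (0 : E2) ρ, 0 < g y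

theorem isInteriorPoint_iff_pos (q : M) :
    (𝓡∂ 2).IsInteriorPoint q ↔ 0 < extChartAt (𝓡∂ 2) q q 0 := by
  rw [ModelWithCorners.IsInteriorPoint, interior_range_modelWithCornersEuclideanHalfSpace]
  rfl

theorem exists_equiv_of_injective {B : E2 →L[ℝ] E2} (hB : Function.Injective B) :
    ∃ e : E2 ≃L[ℝ] E2, (e : E2 →L[ℝ] E2) = B :=
  ⟨(LinearEquiv.ofInjectiveEndo (B : E2 →ₗ[ℝ] E2) hB).toContinuousLinearEquiv, by ext v; rfl⟩

variable {N₀ : E3} {π : E3 →L[ℝ] E2} {ht : E3 →L[ℝ] ℝ} {x N : M → E3}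

theorem IsSpacelikeImmersion.injective_proj (hx : IsSpacelikeImmersion x)
    (hF : IsLorentzFrame N₀ π ht) (a : M) : Function.Injective (π ∘L differential x a) := by
  rw [injective_iff_map_eq_zero]
  intro v hv
  by_contra hne
  have := hx.spacelike a v hne
  rw [ContinuousLinearMap.comp_apply] at hv
  rw [hF.lorentz_eq, hv, inner_zero_left] at this
  nlinarith [sq_nonneg (ht (differential x a v))]

/-- The parameters of the graph at a point where a parametrization `X` with differential `T`, unit
normal `n` with differential `S`, and inverse projection `Ψ` are differentiable. -/
theorem graph_equation_at (hF : IsLorentzFrame N₀ π ht) {X n : E2 → E3} {Ψ : E2 → E2} {p : E3}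
    {y : E2} {T S : E2 →L[ℝ] E3} {L : E2 ≃L[ℝ] E2} {h : ℝ}
    (hX : HasFDerivAt X (T ∘L (L : E2 →L[ℝ] E2)) (Ψ y))
    (hn : HasFDerivAt n (S ∘L (L : E2 →L[ℝ] E2)) (Ψ y))
    (hinj : Function.Injective (π ∘L T)) (hnT : ∀ v, lorentz (n (Ψ y)) (T v) = 0)
    (hunit : lorentz (n (Ψ y)) (n (Ψ y)) = -1) (hpos : 0 < ht (n (Ψ y)))
    (hΨ : ContinuousAt Ψ y) (hproj : ∀ᶠ y' in 𝓝 y, π (X (Ψ y') - p) = y')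
    (hh : pointMeanCurvature T S = h) :
    HasGradientAt (fun y => ht (X (Ψ y) - p)) ((ht (n (Ψ y)))⁻¹ • π (n (Ψ y))) y ∧
    ∃ Q : E2 →L[ℝ] E2, HasFDerivAt (fun y => (ht (n (Ψ y)))⁻¹ • π (n (Ψ y))) Q y ∧
      graphOperator ((ht (n (Ψ y)))⁻¹ • π (n (Ψ y))) Q =
        2 * h * Real.sqrt (1 - ‖(ht (n (Ψ y)))⁻¹ • π (n (Ψ y))‖ ^ 2) ^ 3 := by
  obtain ⟨B, hB⟩ := exists_equiv_of_injective
    (B := π ∘L T ∘L (L : E2 →L[ℝ] E2)) (hinj.comp L.injective)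
  have hpX : HasFDerivAt (fun z => π (X z - p)) (B : E2 →L[ℝ] E2) (Ψ y) := by
    rw [hB]
    exact π.hasFDerivAt.comp (Ψ y) (hX.sub_const p)
  -- A continuous local inverse of a map with invertible derivative is differentiable, so `Ψ` needs
  -- no smoothness assumption.
  have hΨ' : HasFDerivAt Ψ (B.symm : E2 →L[ℝ] E2) y := hpX.of_local_left_inverse hΨ hproj
  have hXΨ : HasFDerivAt (fun y => X (Ψ y))
      (T ∘L ((B.symm.trans L : E2 ≃L[ℝ] E2) : E2 →L[ℝ] E2)) y := hX.comp y hΨ'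
  have hnΨ : HasFDerivAt (fun y => n (Ψ y))
      (S ∘L ((B.symm.trans L : E2 ≃L[ℝ] E2) : E2 →L[ℝ] E2)) y := hn.comp y hΨ'
  set ψ : E2 → E2 := fun y => (ht (n (Ψ y)))⁻¹ • π (n (Ψ y)) with hψ
  have hT : ∀ v, π (T (L (B.symm v))) = v := by
    intro v
    have := congrArg (fun f : E2 →L[ℝ] E2 => f (B.symm v)) hB
    simpa using this.symm
  have hT' : ∀ v, ht (T (L (B.symm v))) = inner ℝ (ψ y) v := by
    intro v
    have := hnT (L (B.symm v))
    rw [hF.lorentz_eq, hT] at this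
    rw [hψ, inner_smul_left, conj_trivial, sub_eq_zero.1 this]
    field_simp
  have hψd : DifferentiableAt ℝ ψ y :=
    ((ht.differentiableAt.comp y hnΨ.differentiableAt).inv hpos.ne').smul
      (π.differentiableAt.comp y hnΨ.differentiableAt)
  have hψ' : ∀ᶠ y' in 𝓝 y, π (n (Ψ y')) = ht (n (Ψ y')) • ψ y' := by
    have : ∀ᶠ y' in 𝓝 y, 0 < ht (n (Ψ y')) :=
      (ht.continuous.continuousAt.comp hnΨ.continuousAt).eventually (lt_mem_nhds hpos)
    filter_upwards [this] with y' hy'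
    rw [hψ, smul_smul, mul_inv_cancel₀ hy'.ne', one_smul]
  refine ⟨?_, fderiv ℝ ψ y, hψd.hasFDerivAt, ?_⟩
  · rw [hasGradientAt_iff_hasFDerivAt]
    refine (ht.hasFDerivAt.comp y (hXΨ.sub_const p)).congr_fderiv ?_
    ext v
    simpa [hψ, inner_smul_left] using hT' v
  · refine graphOperator_eq_of_pointMeanCurvature hF (n := n (Ψ y)) hpos hunit hψ'.self_of_nhds
      (T := T ∘L ((B.symm.trans L : E2 ≃L[ℝ] E2) : E2 →L[ℝ] E2))
      (S := S ∘L ((B.symm.trans L : E2 ≃L[ℝ] E2) : E2 →L[ℝ] E2)) hT hT' ?_ ?_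
    · have h1 := π.hasFDerivAt.comp y hnΨ
      have h2 := (ht.hasFDerivAt.comp y hnΨ).smul hψd.hasFDerivAt
      have h3 := h1.unique (h2.congr_of_eventuallyEq hψ')
      intro v
      simpa using congrArg (fun f : E2 →L[ℝ] E2 => f v) h3
    · rw [pointMeanCurvature_comp, hh]

/-- With `Φ` extending the projected chart, take `u = ht ∘ X ∘ Φ⁻¹` and let `g` be the first
coordinate of `Φ⁻¹`, so that `{0 ≤ g}` is the image of the half-plane. The gradient is read off the
unit normal, which is smooth up to the boundary; this bounds the Hessian there. -/
theorem exists_isLocalGraph [IsManifold (𝓡∂ 2) ∞ M] (hx : IsSpacelikeImmersion x)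
    (hN : IsGaussMap x N) {h : ℝ} (hH : ∀ q, meanCurvature x N q = h) (q : M)
    (hF : IsLorentzFrame (N q) π ht) {V : Set M} (hV : V ∈ 𝓝 q) {e : E2} (he : ‖e‖ = 1)
    (hb : ¬ (𝓡∂ 2).IsInteriorPoint q →
      ∃ κ : ℝ, 0 < κ ∧ ∀ v : E2, v 0 = κ * inner ℝ e (π (differential x q v))) :
    ∃ ρ > 0, ∃ K > 0, ∃ g u ψ Q, IsLocalGraph π ht x (x q) q V h e ρ K g u ψ Q := by
  set φ := extChartAt (𝓡∂ 2) q with hφ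
  set z₀ := φ q with hz₀
  set X := x ∘ φ.symm with hX
  set n := N ∘ φ.symm with hn
  have hsymm : φ.symm z₀ = q := extChartAt_to_inv q
  have hz₀H : z₀ ∈ halfPlane := by
    rw [← range_halfPlane]
    exact extChartAt_target_subset_range q (mem_extChartAt_target q)
  have hXq : X z₀ = x q := by simp [hX, hsymm]
  have hnq : n z₀ = N q := by simp [hn, hsymm]
  have hXs : ContDiffWithinAt ℝ ∞ X halfPlane z₀ := contDiffWithinAt_chart hx.smooth q
  have hns : ContDiffWithinAt ℝ ∞ n halfPlane z₀ := contDiffWithinAt_chart hN.smooth q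
  have hXd : HasFDerivWithinAt X (differential x q) halfPlane z₀ :=
    hasFDerivWithinAt_chart hx.smooth q
  obtain ⟨κ, hκ0, hκ⟩ : ∃ κ : ℝ, 0 < κ ∧ (¬ (𝓡∂ 2).IsInteriorPoint q →
      ∀ v : E2, v 0 = κ * inner ℝ e (π (differential x q v))) := by
    by_cases hi : (𝓡∂ 2).IsInteriorPoint q
    · exact ⟨1, one_pos, fun h => absurd hi h⟩
    · obtain ⟨κ, h1, h2⟩ := hb hi
      exact ⟨κ, h1, fun _ => h2⟩
  obtain ⟨A, hA⟩ := exists_equiv_of_injective (hx.injective_proj hF q)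
  set F : E2 → E2 := fun z => π (X z - x q) with hFdef
  have hFs : ContDiffWithinAt ℝ 2 F halfPlane z₀ :=
    π.contDiff.contDiffAt.comp_contDiffWithinAt z₀
      ((hXs.of_le ENat.LEInfty.out).sub contDiffWithinAt_const)
  have hFd : HasFDerivWithinAt F (A : E2 →L[ℝ] E2) halfPlane z₀ := by
    rw [hA]
    exact π.hasFDerivAt.comp_hasFDerivWithinAt z₀ (hXd.sub_const (x q))
  set ψ₀ : E2 → E2 := fun z => (ht (n z))⁻¹ • π (n z) with hψ₀
  have hhtn : ht (n z₀) = 1 := by rw [hnq]; exact hF.height_normal (hN.unit q)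
  have hhts : ContDiffWithinAt ℝ 1 (fun z => ht (n z)) halfPlane z₀ :=
    ht.contDiff.contDiffAt.comp_contDiffWithinAt z₀ (hns.of_le (by exact_mod_cast le_top))
  have hψs : ContDiffWithinAt ℝ 1 ψ₀ halfPlane z₀ :=
    (hhts.inv (by rw [hhtn]; exact one_ne_zero)).smul
      (π.contDiff.contDiffAt.comp_contDiffWithinAt z₀ (hns.of_le (by exact_mod_cast le_top)))
  have hψz₀ : ψ₀ z₀ = 0 := by simp [hψ₀, hnq, hF.proj_normal]
  obtain ⟨k, t, htn, hk⟩ := hψs.exists_lipschitzOnWith convex_halfPlane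
  have ev1 : ∀ᶠ z in 𝓝[halfPlane] z₀, ‖ψ₀ z‖ < 1 / 2 := by
    have := hψs.continuousWithinAt.norm.tendsto
    rw [hψz₀, norm_zero] at this
    exact this.eventually (gt_mem_nhds (by norm_num))
  have ev2 : ∀ᶠ z in 𝓝[halfPlane] z₀, 0 < ht (n z) :=
    hhts.continuousWithinAt.tendsto.eventually (lt_mem_nhds (by rw [hhtn]; exact one_pos))
  have ev3 : ∀ᶠ z in 𝓝[halfPlane] z₀, ContinuousWithinAt X halfPlane z := by
    have := (hXs.of_le (m := 1) (by exact_mod_cast le_top)).eventually (by simp)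
    rw [Set.insert_eq_of_mem hz₀H] at this
    exact this.mono fun z hz => hz.continuousWithinAt
  obtain ⟨Φ, r, hr, K, hK, hΦF, hΦ₀, hlip, hlin, hquad⟩ :=
    exists_homeomorph_extension_halfPlane hz₀H hFs (by simp [hFdef, hXq]) hFd
      (Filter.inter_mem htn (ev1.and (ev2.and (ev3.and (eventually_chart_symm_mem hV)))))
      (half_pos hκ0)
  -- At an interior point, `K * ρ ≤ z₀ 0` keeps `Φ⁻¹` of the ball inside the open half-plane.
  obtain ⟨ρ, hρ0, hρr, hρi⟩ : ∃ ρ > 0, K * ρ ≤ r ∧ (0 < z₀ 0 → K * ρ ≤ z₀ 0) := by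
    by_cases hp : 0 < z₀ 0
    · refine ⟨min r (z₀ 0) / K, by positivity, ?_, fun _ => ?_⟩ <;>
        rw [mul_div_cancel₀ _ hK.ne']
      · exact min_le_left _ _
      · exact min_le_right _ _
    · exact ⟨r / K, by positivity, by rw [mul_div_cancel₀ _ hK.ne'], fun h => absurd h hp⟩
  have hlip₀ : ∀ y, ‖Φ.symm y - z₀‖ ≤ K * ‖y‖ := fun y => by
    simpa [hΦ₀] using hlip y 0
  have hball : ∀ y ∈ Metric.ball (0 : E2) ρ, dist (Φ.symm y) z₀ < r := by
    intro y hy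
    rw [mem_ball_zero_iff] at hy
    rw [dist_eq_norm]
    exact (hlip₀ y).trans_lt ((mul_lt_mul_of_pos_left hy hK).trans_le hρr)
  have hgc : Continuous fun y => (Φ.symm y) 0 :=
    (by fun_prop : Continuous fun z : E2 => z 0).comp Φ.symm.continuous
  have hint : (𝓡∂ 2).IsInteriorPoint q → ∀ y ∈ Metric.ball (0 : E2) ρ, 0 < (Φ.symm y) 0 := by
    intro hi y hy
    rw [isInteriorPoint_iff_pos] at hi
    rw [mem_ball_zero_iff] at hy
    have h1 := (abs_apply_le_norm (Φ.symm y - z₀) 0).trans (hlip₀ y)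
    have h2 := (mul_lt_mul_of_pos_left hy hK).trans_le (hρi hi)
    rw [PiLp.sub_apply] at h1
    linarith [neg_abs_le ((Φ.symm y) 0 - z₀ 0)]
  have hAe : ¬ (𝓡∂ 2).IsInteriorPoint q → ∀ y, (A.symm y) 0 = κ * inner ℝ e y := by
    intro hi y
    rw [hκ hi (A.symm y)]
    have := congrArg (fun f : E2 →L[ℝ] E2 => f (A.symm y)) hA
    simp only [ContinuousLinearEquiv.coe_coe, ContinuousLinearEquiv.apply_symm_apply,
      ContinuousLinearMap.comp_apply] at this
    rw [← this]
  -- everything that happens at a point of the open domain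
  have main : ∀ y ∈ Metric.ball (0 : E2) ρ, 0 < (Φ.symm y) 0 →
      HasGradientAt (fun y => ht (X (Φ.symm y) - x q)) (ψ₀ (Φ.symm y)) y ∧
      ∃ Q : E2 →L[ℝ] E2, HasFDerivAt (fun y => ψ₀ (Φ.symm y)) Q y ∧
        graphOperator (ψ₀ (Φ.symm y)) Q =
          2 * h * Real.sqrt (1 - ‖ψ₀ (Φ.symm y)‖ ^ 2) ^ 3 := by
    intro y hy hg
    obtain ⟨⟨-, -, hpos, -, htar, -⟩, -⟩ := hΦF (Φ.symm y) hg.le (hball y hy)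
    obtain ⟨L, hL⟩ := exists_hasFDerivAt_chart q htar hg
    have hproj : ∀ᶠ y' in 𝓝 y, π (X (Φ.symm y') - x q) = y' := by
      filter_upwards [Metric.isOpen_ball.mem_nhds hy,
        (isOpen_lt continuous_const hgc).mem_nhds hg] with y' h1 h2
      have := (hΦF (Φ.symm y') (le_of_lt h2) (hball y' h1)).2
      rw [Φ.apply_symm_apply] at this
      exact this.symm
    exact graph_equation_at hF (X := X) (n := n) (hL x hx.smooth) (hL N hN.smooth)
      (hx.injective_proj hF _) (hN.normal _) (hN.unit _) hpos Φ.symm.continuous.continuousAt hproj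
      ((meanCurvature_eq_pointMeanCurvature x N _).symm.trans (hH _))
  -- `k * K` is a Lipschitz constant of the gradient and hence bounds the Hessian; `K / κ` is the
  -- opening of the paraboloid.
  refine ⟨ρ, hρ0, max (k * K) (K / κ), lt_max_of_lt_right (by positivity), fun y => (Φ.symm y) 0,
    fun y => ht (X (Φ.symm y) - x q), fun y => ψ₀ (Φ.symm y),
    fun y => fderiv ℝ (fun y => ψ₀ (Φ.symm y)) y, ?_⟩
  refine
    { continuous_domain := hgc
      eventually_mem := ?_
      exists_eq := ?_
      gradient := fun y hy hg => (main y hy hg).1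
      hessian := fun y hy hg => ?_
      slope := fun y hy hg => (hΦF _ hg.le (hball y hy)).1.2.1.le
      bound := fun y hy hg => ?_
      equation := fun y hy hg => ?_
      continuousOn := ?_
      isLittleO := ?_
      paraboloid := ?_
      translate := ?_
      interior := hint }
  · have hcont : Filter.Tendsto φ (𝓝 q) (𝓝 z₀) := continuousAt_extChartAt q
    filter_upwards [extChartAt_source_mem_nhds (I := 𝓡∂ 2) q,
      hcont.eventually (Metric.ball_mem_nhds z₀ hr)] with a ha1 ha2
    have haH : φ a ∈ halfPlane := by
      rw [← range_halfPlane]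
      exact extChartAt_target_subset_range q (φ.map_source ha1)
    have h1 := (hΦF (φ a) haH ha2).2
    have h2 : F (φ a) = π (x a - x q) := by simp only [hFdef, hX, Function.comp, φ.left_inv ha1]
    have h3 : Φ.symm (π (x a - x q)) = φ a := by rw [Homeomorph.symm_apply_eq, h1, h2]
    rw [h3]
    exact ⟨haH, by simp only [hX, Function.comp, φ.left_inv ha1]⟩
  · intro y hy hg
    obtain ⟨⟨-, -, -, -, -, hmem⟩, hy'⟩ := hΦF (Φ.symm y) hg (hball y hy)
    rw [Φ.apply_symm_apply] at hy'
    exact ⟨φ.symm (Φ.symm y), hmem, hy'.symm, rfl⟩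
  · obtain ⟨-, Q, hQ, -⟩ := main y hy hg
    exact hQ.differentiableAt.hasFDerivAt
  · obtain ⟨-, Q, hQ, -⟩ := main y hy hg
    refine le_trans ?_ (le_max_left _ _)
    rw [hQ.fderiv]
    refine hQ.le_of_lip' (by positivity) ?_
    filter_upwards [Metric.isOpen_ball.mem_nhds hy,
      (isOpen_lt continuous_const hgc).mem_nhds hg] with y' h1 h2
    have h3 := hk.norm_sub_le (hΦF _ (le_of_lt h2) (hball y' h1)).1.1
      (hΦF _ hg.le (hball y hy)).1.1
    rw [mul_assoc]
    exact h3.trans (mul_le_mul_of_nonneg_left (hlip y' y) k.2)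
  · obtain ⟨-, Q, hQ, heq⟩ := main y hy hg
    rw [hQ.fderiv]
    exact heq
  · intro y hy
    have h1 := (hΦF _ hy.2 (hball y hy.1)).1.2.2.2.1
    have h2 : ContinuousWithinAt (fun y => X (Φ.symm y))
        (Metric.ball 0 ρ ∩ {y | 0 ≤ (Φ.symm y) 0}) y :=
      h1.comp Φ.symm.continuous.continuousWithinAt fun y' hy' => hy'.2
    exact ht.continuous.continuousAt.comp_continuousWithinAt (h2.sub continuousWithinAt_const)
  · intro ε hε
    have h1 : HasFDerivWithinAt (fun z => ht (X z - x q)) (0 : E2 →L[ℝ] ℝ) halfPlane z₀ := by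
      refine (ht.hasFDerivAt.comp_hasFDerivWithinAt z₀ (hXd.sub_const (x q))).congr_fderiv ?_
      ext v
      have := hN.normal q v
      rw [lorentz_comm] at this
      simp [hF.height_eq, this]
    have h2 := h1.isLittleO.def (c := ε / K) (by positivity)
    obtain ⟨δ, hδ, hsub⟩ := Metric.mem_nhdsWithin_iff.1 h2
    refine ⟨δ / K, by positivity, fun y hy hg => ?_⟩
    have h3 : Φ.symm y ∈ Metric.ball z₀ δ ∩ halfPlane := by
      refine ⟨?_, hg⟩
      rw [Metric.mem_ball, dist_eq_norm]
      refine (hlip₀ y).trans_lt ?_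
      rwa [lt_div_iff₀' hK] at hy
    have h4 := hsub h3
    simp only [Set.mem_ofPred_eq, hXq, sub_self, map_zero, sub_zero, Real.norm_eq_abs,
      zero_apply] at h4
    refine h4.trans ?_
    calc ε / K * ‖Φ.symm y - z₀‖ ≤ ε / K * (K * ‖y‖) :=
          mul_le_mul_of_nonneg_left (hlip₀ y) (by positivity)
      _ = ε * ‖y‖ := by field_simp
  · intro y hy hlt
    by_cases hi : (𝓡∂ 2).IsInteriorPoint q
    · exact hint hi y hy
    have hz0 : 0 ≤ z₀ 0 := hz₀H
    -- To first order `g` is `z₀ 0 + κ⟨e, y⟩`, with error at most `K‖y‖²`.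
    have h1 := (abs_apply_le_norm _ 0).trans (hquad y)
    simp only [PiLp.sub_apply, hAe hi] at h1
    have h2 : K / κ * ‖y‖ ^ 2 < inner ℝ e y :=
      lt_of_le_of_lt (mul_le_mul_of_nonneg_right (le_max_right _ _) (by positivity)) hlt
    rw [div_mul_eq_mul_div, div_lt_iff₀' hκ0] at h2
    linarith [(abs_le.1 h1).1]
  · intro y hy hg t ht0 hyt
    by_cases hi : (𝓡∂ 2).IsInteriorPoint q
    · exact hint hi _ hyt
    -- A translation by `t • e` raises `g` by `κ t` up to an error `(κ / 2) t`; this is why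
    -- `exists_homeomorph_extension_halfPlane` was applied with `η = κ / 2`.
    have h1 := (abs_apply_le_norm _ 0).trans (hlin (y + t • e) y)
    simp only [add_sub_cancel_left, PiLp.sub_apply, hAe hi, inner_smul_right,
      real_inner_self_eq_norm_sq, norm_smul, he, Real.norm_eq_abs, abs_of_pos ht0] at h1
    nlinarith [(abs_le.1 h1).1, mul_pos hκ0 ht0]

end LorentzMinkowski

namespace LorentzMinkowski

/-! ### Comparison of two local graphs -/

theorem graphOperator_sub (p : E2) (Q Q' : E2 →L[ℝ] E2) :
    graphOperator p (Q - Q') = graphOperator p Q - graphOperator p Q' := by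
  simp only [graphOperator, planeTrace, sub_apply, PiLp.sub_apply, inner_sub_right]
  ring

theorem abs_planeTrace_le (Q : E2 →L[ℝ] E2) : |planeTrace Q| ≤ 2 * ‖Q‖ := by
  have h : ∀ i, |Q (EuclideanSpace.single i 1) i| ≤ ‖Q‖ := fun i =>
    (abs_apply_le_norm _ i).trans (by simpa using Q.le_opNorm (EuclideanSpace.single i 1))
  exact (abs_add_le _ _).trans (by linarith [h 0, h 1])

theorem abs_norm_sq_sub_le {p p' : E2} (hp : ‖p‖ ≤ 1 / 2) (hp' : ‖p'‖ ≤ 1 / 2) :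
    |‖p‖ ^ 2 - ‖p'‖ ^ 2| ≤ ‖p - p'‖ := by
  rw [sq_sub_sq, abs_mul, abs_of_nonneg (by positivity)]
  exact (mul_le_of_le_one_left (abs_nonneg _) (by linarith)).trans (abs_norm_sub_norm_le p p')

theorem abs_graphOperator_sub_le {p p' : E2} (hp : ‖p‖ ≤ 1 / 2) (hp' : ‖p'‖ ≤ 1 / 2)
    (Q : E2 →L[ℝ] E2) : |graphOperator p Q - graphOperator p' Q| ≤ 3 * ‖Q‖ * ‖p - p'‖ := by
  have h1 : graphOperator p Q - graphOperator p' Q =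
      -((‖p‖ ^ 2 - ‖p'‖ ^ 2) * planeTrace Q) + (inner ℝ (p - p') (Q p) + inner ℝ p' (Q (p - p'))) := by
    simp only [graphOperator, inner_sub_left, map_sub, inner_sub_right]
    ring
  rw [h1]
  have h2 : |(‖p‖ ^ 2 - ‖p'‖ ^ 2) * planeTrace Q| ≤ ‖p - p'‖ * (2 * ‖Q‖) := by
    rw [abs_mul]
    exact mul_le_mul (abs_norm_sq_sub_le hp hp') (abs_planeTrace_le Q) (abs_nonneg _)
      (norm_nonneg _)
  have h3 : |inner ℝ (p - p') (Q p)| ≤ ‖p - p'‖ * (‖Q‖ * (1 / 2)) :=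
    (abs_real_inner_le_norm _ _).trans (by
      gcongr
      exact (Q.le_opNorm p).trans (by gcongr))
  have h4 : |inner ℝ p' (Q (p - p'))| ≤ 1 / 2 * (‖Q‖ * ‖p - p'‖) :=
    (abs_real_inner_le_norm _ _).trans (by
      gcongr
      exact Q.le_opNorm _)
  refine (abs_add_le _ _).trans ?_
  rw [abs_neg]
  refine (add_le_add h2 ((abs_add_le _ _).trans (add_le_add h3 h4))).trans (le_of_eq ?_)
  ring

theorem abs_sqrt_cube_sub_le {p p' : E2} (hp : ‖p‖ ≤ 1 / 2) (hp' : ‖p'‖ ≤ 1 / 2) :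
    |Real.sqrt (1 - ‖p‖ ^ 2) ^ 3 - Real.sqrt (1 - ‖p'‖ ^ 2) ^ 3| ≤ 3 * ‖p - p'‖ := by
  have key : ∀ p : E2, ‖p‖ ≤ 1 / 2 → 1 / 2 ≤ Real.sqrt (1 - ‖p‖ ^ 2) ∧
      Real.sqrt (1 - ‖p‖ ^ 2) ≤ 1 ∧ Real.sqrt (1 - ‖p‖ ^ 2) ^ 2 = 1 - ‖p‖ ^ 2 := by
    intro p hp
    have h : ‖p‖ ^ 2 ≤ 1 / 4 := by nlinarith [norm_nonneg p]
    refine ⟨Real.le_sqrt_of_sq_le (by linarith), ?_, Real.sq_sqrt (by linarith)⟩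
    exact Real.sqrt_le_iff.2 ⟨zero_le_one, by linarith [sq_nonneg ‖p‖]⟩
  obtain ⟨a1, a2, a3⟩ := key p hp
  obtain ⟨b1, b2, b3⟩ := key p' hp'
  set a := Real.sqrt (1 - ‖p‖ ^ 2)
  set b := Real.sqrt (1 - ‖p'‖ ^ 2)
  have h1 : |a - b| ≤ ‖p - p'‖ := by
    refine le_trans ?_ (abs_norm_sq_sub_le hp hp')
    have : ‖p‖ ^ 2 - ‖p'‖ ^ 2 = -((a + b) * (a - b)) := by linear_combination a3 - b3
    rw [this, abs_neg, abs_mul, abs_of_nonneg (by linarith : 0 ≤ a + b)]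
    exact le_mul_of_one_le_left (abs_nonneg _) (by linarith)
  rw [show a ^ 3 - b ^ 3 = (a ^ 2 + a * b + b ^ 2) * (a - b) by ring, abs_mul,
    abs_of_nonneg (by positivity)]
  exact mul_le_mul (by nlinarith) h1 (abs_nonneg _) (by norm_num)

section Pair

variable {M₁ M₂ : Type*} [TopologicalSpace M₁] [ChartedSpace (EuclideanHalfSpace 2) M₁]
  [TopologicalSpace M₂] [ChartedSpace (EuclideanHalfSpace 2) M₂]
  {π : E3 →L[ℝ] E2} {ht : E3 →L[ℝ] ℝ} {x₁ : M₁ → E3} {x₂ : M₂ → E3} {p : E3} {q₁ : M₁} {q₂ : M₂}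
  {V₁ : Set M₁} {V₂ : Set M₂} {h : ℝ} {e : E2} {ρ₁ ρ₂ K₁ K₂ : ℝ} {g₁ g₂ u₁ u₂ : E2 → ℝ}
  {ψ₁ ψ₂ : E2 → E2} {Q₁ Q₂ : E2 → E2 →L[ℝ] E2}

/-- The difference of two graphs of the same mean curvature is controlled by its gradient. -/
theorem IsLocalGraph.isGradientControlled_sub
    (h₁ : IsLocalGraph π ht x₁ p q₁ V₁ h e ρ₁ K₁ g₁ u₁ ψ₁ Q₁)
    (h₂ : IsLocalGraph π ht x₂ p q₂ V₂ h e ρ₂ K₂ g₂ u₂ ψ₂ Q₂) :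
    IsGradientControlled
      ((Metric.ball 0 ρ₁ ∩ {y | 0 < g₁ y}) ∩ (Metric.ball 0 ρ₂ ∩ {y | 0 < g₂ y}))
      (fun y => u₂ y - u₁ y) (fun y => ψ₂ y - ψ₁ y) ψ₂ (fun y => Q₂ y - Q₁ y)
      (3 * K₁ + 6 * |h|) where
  gradient := by
    rintro y ⟨⟨hy₁, hg₁⟩, hy₂, hg₂⟩
    rw [hasGradientAt_iff_hasFDerivAt, map_sub]
    exact (h₂.gradient y hy₂ hg₂).hasFDerivAt.sub (h₁.gradient y hy₁ hg₁).hasFDerivAt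
  hessian := by
    rintro y ⟨⟨hy₁, hg₁⟩, hy₂, hg₂⟩
    exact (h₂.hessian y hy₂ hg₂).sub (h₁.hessian y hy₁ hg₁)
  slope := fun y hy => h₂.slope y hy.2.1 hy.2.2
  bound := by
    rintro y ⟨⟨hy₁, hg₁⟩, hy₂, hg₂⟩
    have e₁ := h₁.equation y hy₁ hg₁
    have e₂ := h₂.equation y hy₂ hg₂
    have s₁ := h₁.slope y hy₁ hg₁
    have s₂ := h₂.slope y hy₂ hg₂
    -- The coefficients are frozen at `ψ₂`; the differences that remain are Lipschitz in the slope.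
    have h3 : graphOperator (ψ₂ y) (Q₂ y - Q₁ y) =
        2 * h * (Real.sqrt (1 - ‖ψ₂ y‖ ^ 2) ^ 3 - Real.sqrt (1 - ‖ψ₁ y‖ ^ 2) ^ 3) -
          (graphOperator (ψ₂ y) (Q₁ y) - graphOperator (ψ₁ y) (Q₁ y)) := by
      rw [graphOperator_sub, e₂, e₁]
      ring
    rw [h3]
    refine (abs_sub _ _).trans ?_
    rw [abs_mul, abs_mul, abs_two]
    have h4 := mul_le_mul_of_nonneg_left (abs_sqrt_cube_sub_le s₂ s₁)
      (by positivity : 0 ≤ 2 * |h|)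
    have h5 := abs_graphOperator_sub_le s₂ s₁ (Q₁ y)
    have h6 : 3 * ‖Q₁ y‖ * ‖ψ₂ y - ψ₁ y‖ ≤ 3 * K₁ * ‖ψ₂ y - ψ₁ y‖ := by
      gcongr
      exact h₁.bound y hy₁ hg₁
    linarith

/-- Two ordered local graphs of the same mean curvature, tangent at the origin, agree near it. -/
theorem IsLocalGraph.eventually_eq (he : ‖e‖ = 1) (hρ₁ : 0 < ρ₁) (hρ₂ : 0 < ρ₂) (hK₁ : 0 < K₁)
    (hK₂ : 0 < K₂)
    (h₁ : IsLocalGraph π ht x₁ p q₁ V₁ h e ρ₁ K₁ g₁ u₁ ψ₁ Q₁)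
    (h₂ : IsLocalGraph π ht x₂ p q₂ V₂ h e ρ₂ K₂ g₂ u₂ ψ₂ Q₂)
    (hle : ∀ a ∈ V₁, ∀ b ∈ V₂, π (x₁ a - p) = π (x₂ b - p) → ht (x₁ a - p) ≤ ht (x₂ b - p)) :
    ∃ η > 0, ∀ y : E2, ‖y‖ < η → 0 ≤ g₁ y → 0 ≤ g₂ y → u₁ y = u₂ y := by
  set Ω := (Metric.ball 0 ρ₁ ∩ {y | 0 < g₁ y}) ∩ (Metric.ball 0 ρ₂ ∩ {y | 0 < g₂ y}) with hΩ
  have hΩo : IsOpen Ω :=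
    (Metric.isOpen_ball.inter (isOpen_lt continuous_const h₁.continuous_domain)).inter
      (Metric.isOpen_ball.inter (isOpen_lt continuous_const h₂.continuous_domain))
  have hw := h₁.isGradientControlled_sub h₂
  rw [← hΩ] at hw
  have hC : 0 ≤ 3 * K₁ + 6 * |h| := by positivity
  have hnn : ∀ y ∈ Ω, 0 ≤ u₂ y - u₁ y := by
    rintro y ⟨⟨hy₁, hg₁⟩, hy₂, hg₂⟩
    obtain ⟨a, ha, ha1, ha2⟩ := h₁.exists_eq y hy₁ (le_of_lt hg₁)
    obtain ⟨b, hb, hb1, hb2⟩ := h₂.exists_eq y hy₂ (le_of_lt hg₂)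
    have := hle a ha b hb (ha1.trans hb1.symm)
    rw [ha2, hb2] at this
    linarith
  -- The tangent ball is `‖y‖² < 2R⟨e, y⟩`, so `2 * R * K ≤ 1` places it inside both paraboloids.
  obtain ⟨R, hR, hRρ₁, hRρ₂, hRK₁, hRK₂⟩ :
      ∃ R > 0, 2 * R ≤ ρ₁ ∧ 2 * R ≤ ρ₂ ∧ 2 * R * K₁ ≤ 1 ∧ 2 * R * K₂ ≤ 1 := by
    refine ⟨min (min (ρ₁ / 2) (ρ₂ / 2)) (min (1 / (2 * K₁)) (1 / (2 * K₂))), by positivity, ?_⟩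
    set R := min (min (ρ₁ / 2) (ρ₂ / 2)) (min (1 / (2 * K₁)) (1 / (2 * K₂)))
    have l1 : R ≤ ρ₁ / 2 := (min_le_left _ _).trans (min_le_left _ _)
    have l2 : R ≤ ρ₂ / 2 := (min_le_left _ _).trans (min_le_right _ _)
    have l3 : R ≤ 1 / (2 * K₁) := (min_le_right _ _).trans (min_le_left _ _)
    have l4 : R ≤ 1 / (2 * K₂) := (min_le_right _ _).trans (min_le_right _ _)
    rw [le_div_iff₀ (by positivity)] at l3 l4
    exact ⟨by linarith, by linarith, by linarith, by linarith⟩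
  -- the ball of radius `R` tangent at the origin
  set B := Metric.ball (R • e) R with hB
  have hB2 : ∀ y ∈ B, ‖y‖ < 2 * R ∧ ‖y‖ ^ 2 < 2 * R * inner ℝ e y := by
    intro y hy
    rw [hB, Metric.mem_ball, dist_eq_norm] at hy
    constructor
    · have := norm_add_le (y - R • e) (R • e)
      rw [sub_add_cancel, norm_smul, he, Real.norm_eq_abs, abs_of_pos hR] at this
      linarith
    · have h1 : ‖y - R • e‖ ^ 2 < R ^ 2 := pow_lt_pow_left₀ hy (norm_nonneg _) two_ne_zero
      rw [norm_sub_sq_real, norm_smul, he, inner_smul_right, real_inner_comm, Real.norm_eq_abs,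
        mul_one, sq_abs] at h1
      linarith
  have hBpara : ∀ K, 0 < K → 2 * R * K ≤ 1 → ∀ y ∈ B, K * ‖y‖ ^ 2 < inner ℝ e y := by
    intro K hK hRK y hy
    have h1 := (hB2 y hy).2
    have h2 : 0 < inner ℝ e y := by
      by_contra! h0
      nlinarith [sq_nonneg ‖y‖]
    calc K * ‖y‖ ^ 2 < K * (2 * R * inner ℝ e y) := mul_lt_mul_of_pos_left h1 hK
      _ = (2 * R * K) * inner ℝ e y := by ring
      _ ≤ 1 * inner ℝ e y := mul_le_mul_of_nonneg_right hRK h2.le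
      _ = _ := one_mul _
  have hBΩ : B ⊆ Ω := by
    intro y hy
    have b₁ : y ∈ Metric.ball (0 : E2) ρ₁ := mem_ball_zero_iff.2 ((hB2 y hy).1.trans_le hRρ₁)
    have b₂ : y ∈ Metric.ball (0 : E2) ρ₂ := mem_ball_zero_iff.2 ((hB2 y hy).1.trans_le hRρ₂)
    exact ⟨⟨b₁, h₁.paraboloid y b₁ (hBpara K₁ hK₁ hRK₁ y hy)⟩,
      b₂, h₂.paraboloid y b₂ (hBpara K₂ hK₂ hRK₂ y hy)⟩
  -- the difference vanishes somewhere in the ball, hence on the ball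
  obtain ⟨y₀, hy₀, hy₀'⟩ : ∃ y ∈ B, u₂ y - u₁ y = 0 := by
    by_contra! hne
    obtain ⟨ε, hε, hopf⟩ := (hw.mono hBΩ).hopf hR hC
      (fun y hy => lt_of_le_of_ne (hnn y (hBΩ hy)) (hne y hy).symm) (z := 0)
      (by rw [dist_zero_left, norm_smul, he, Real.norm_eq_abs, abs_of_pos hR, mul_one])
    -- At the point `(t * R) • e` each `|uᵢ|` is then at most `ε t / 4`, so their difference cannot
    -- reach the `ε t` forced by Hopf's lemma.
    obtain ⟨δ₁, hδ₁, l₁⟩ := h₁.isLittleO (ε / (4 * R)) (by positivity)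
    obtain ⟨δ₂, hδ₂, l₂⟩ := h₂.isLittleO (ε / (4 * R)) (by positivity)
    obtain ⟨t, ht0, ht1, ht2, ht3⟩ : ∃ t : ℝ, 0 < t ∧ t < 1 / 2 ∧ t * R < δ₁ ∧ t * R < δ₂ := by
      refine ⟨min (1 / 3) (min (δ₁ / (2 * R)) (δ₂ / (2 * R))), by positivity,
        (min_le_left _ _).trans_lt (by norm_num), ?_, ?_⟩
      · have h3 := (min_le_right (1 / 3) (min (δ₁ / (2 * R)) (δ₂ / (2 * R)))).trans
          (min_le_left _ _)
        rw [le_div_iff₀ (by positivity)] at h3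
        linarith
      · have h3 := (min_le_right (1 / 3) (min (δ₁ / (2 * R)) (δ₂ / (2 * R)))).trans
          (min_le_right _ _)
        rw [le_div_iff₀ (by positivity)] at h3
        linarith
    have hy : (0 : E2) + t • (R • e - 0) = (t * R) • e := by rw [zero_add, sub_zero, smul_smul]
    have hn : ‖(t * R) • e‖ = t * R := by
      rw [norm_smul, he, Real.norm_eq_abs, abs_of_pos (by positivity), mul_one]
    have hyB : (t * R) • e ∈ B := by
      rw [hB, Metric.mem_ball, dist_eq_norm, ← sub_smul, norm_smul, he, Real.norm_eq_abs,
        abs_of_neg (by nlinarith)]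
      nlinarith
    have h3 := hopf t ht0 ht1
    rw [hy] at h3
    have h4 := l₁ _ (by rwa [hn]) (le_of_lt (hBΩ hyB).1.2)
    have h5 := l₂ _ (by rwa [hn]) (le_of_lt (hBΩ hyB).2.2)
    rw [hn] at h4 h5
    have h6 : ε / (4 * R) * (t * R) = ε * t / 4 := by field_simp
    rw [h6] at h4 h5
    linarith [neg_abs_le (u₁ ((t * R) • e)), le_abs_self (u₂ ((t * R) • e)), mul_pos hε ht0]
  have hB0 := hw.eqOn_zero hΩo hC hnn (convex_ball _ _).isPreconnected hBΩ hy₀ hy₀'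
  -- `‖y‖ < R` says exactly that `y + R • e` lies in the tangent ball.
  refine ⟨R, hR, fun y hy hg₁ hg₂ => ?_⟩
  -- translate along the axis
  have hyt : ∀ t : ℝ, 0 < t → t ≤ R → ‖y + t • e‖ < 2 * R := by
    intro t ht0 ht1
    have := norm_add_le y (t • e)
    rw [norm_smul, he, Real.norm_eq_abs, abs_of_pos ht0] at this
    linarith
  have hyρ₁ : y ∈ Metric.ball (0 : E2) ρ₁ := mem_ball_zero_iff.2 (by linarith)
  have hyρ₂ : y ∈ Metric.ball (0 : E2) ρ₂ := mem_ball_zero_iff.2 (by linarith)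
  set γ : ℝ → E2 := fun t => y + t • e with hγ
  have hγc : Continuous γ := by fun_prop
  have hseg : γ '' Set.Ioc 0 R ⊆ Ω := by
    rintro _ ⟨t, ⟨ht0, ht1⟩, rfl⟩
    have b₁ : γ t ∈ Metric.ball (0 : E2) ρ₁ :=
      mem_ball_zero_iff.2 ((hyt t ht0 ht1).trans_le hRρ₁)
    have b₂ : γ t ∈ Metric.ball (0 : E2) ρ₂ :=
      mem_ball_zero_iff.2 ((hyt t ht0 ht1).trans_le hRρ₂)
    exact ⟨⟨b₁, h₁.translate y hyρ₁ hg₁ t ht0 b₁⟩, b₂, h₂.translate y hyρ₂ hg₂ t ht0 b₂⟩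
  have hyR : γ R ∈ B := by
    rw [hB, Metric.mem_ball, dist_eq_norm]
    simpa [hγ] using hy
  have hz := hw.eqOn_zero hΩo hC hnn
    (isPreconnected_Ioc.image γ hγc.continuousOn) hseg
    (Set.mem_image_of_mem γ ⟨hR, le_refl R⟩) (hB0 _ hyR)
  have hlim : Filter.Tendsto γ (𝓝[>] 0) (𝓝 y) := by
    have : Filter.Tendsto γ (𝓝 0) (𝓝 (γ 0)) := hγc.tendsto 0
    simp only [hγ, zero_smul, add_zero] at this
    exact this.mono_left nhdsWithin_le_nhds
  have hev : ∀ᶠ t in 𝓝[>] (0 : ℝ), γ t ∈ γ '' Set.Ioc 0 R := by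
    filter_upwards [Ioc_mem_nhdsGT hR] with t ht using Set.mem_image_of_mem γ ht
  have c₁ : Filter.Tendsto (fun t => u₁ (γ t)) (𝓝[>] 0) (𝓝 (u₁ y)) :=
    (h₁.continuousOn y ⟨hyρ₁, hg₁⟩).tendsto.comp (tendsto_nhdsWithin_iff.2
      ⟨hlim, hev.mono fun t ht => ⟨(hseg ht).1.1, (show 0 < g₁ (γ t) from (hseg ht).1.2).le⟩⟩)
  have c₂ : Filter.Tendsto (fun t => u₂ (γ t)) (𝓝[>] 0) (𝓝 (u₂ y)) :=
    (h₂.continuousOn y ⟨hyρ₂, hg₂⟩).tendsto.comp (tendsto_nhdsWithin_iff.2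
      ⟨hlim, hev.mono fun t ht => ⟨(hseg ht).2.1, (show 0 < g₂ (γ t) from (hseg ht).2.2).le⟩⟩)
  refine tendsto_nhds_unique c₁ (c₂.congr' ?_)
  filter_upwards [hev] with t ht
  linarith [hz _ ht]

end Pair

/-! ### The common inner direction -/

section Direction

variable {M : Type*} [TopologicalSpace M] [ChartedSpace (EuclideanHalfSpace 2) M]
  {N₀ : E3} {π : E3 →L[ℝ] E2} {ht : E3 →L[ℝ] ℝ} {x N : M → E3}

/-- `e` is the inner unit normal of the projected surface at a boundary point. -/
def IsInnerDirection (π : E3 →L[ℝ] E2) (x : M → E3) (q : M) (e : E2) : Prop :=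
  ∃ κ : ℝ, 0 < κ ∧ ∀ v : E2, v 0 = κ * inner ℝ e (π (differential x q v))

/-- `e` is the normalized Riesz vector of the inner coordinate transported to the plane by the
projected differential. -/
theorem IsSpacelikeImmersion.exists_isInnerDirection (hx : IsSpacelikeImmersion x)
    (hF : IsLorentzFrame N₀ π ht) (q : M) : ∃ e, ‖e‖ = 1 ∧ IsInnerDirection π x q e := by
  obtain ⟨A, hA⟩ := exists_equiv_of_injective (hx.injective_proj hF q)
  set l : E2 →L[ℝ] ℝ := EuclideanSpace.proj (0 : Fin 2) ∘L (A.symm : E2 →L[ℝ] E2) with hl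
  set f := (InnerProductSpace.toDual ℝ E2).symm l with hf
  have hfl : ∀ y, inner ℝ f y = (A.symm y) 0 := fun y => by
    rw [hf, InnerProductSpace.toDual_symm_apply]; rfl
  have hf0 : f ≠ 0 := by
    intro h0
    have := hfl (A (EuclideanSpace.single 0 1))
    simp [h0] at this
  refine ⟨‖f‖⁻¹ • f, by simp [norm_smul, hf0], ‖f‖, norm_pos_iff.2 hf0, fun v => ?_⟩
  have hv : π (differential x q v) = A v := by
    have := congrArg (fun B : E2 →L[ℝ] E2 => B v) hA
    exact this.symm
  rw [hv, inner_smul_left, hfl, A.symm_apply_apply, conj_trivial,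
    mul_inv_cancel_left₀ (norm_ne_zero_iff.2 hf0)]

/-- On the tangent plane at `q` heights vanish and `π` is isometric. If `ν` is the image of `v₀`,
then `v₀ 0 • v - v 0 • v₀` is tangent to the boundary, and its orthogonality to `ν` is the claim
with `κ = v₀ 0`. A shared conormal thus gives a shared direction. -/
theorem IsGaussMap.isInnerDirection_conormal (hN : IsGaussMap x N) (q : M)
    (hF : IsLorentzFrame (N q) π ht) {ν : E3} (hν : IsInteriorConormal x q ν) :
    ‖π ν‖ = 1 ∧ IsInnerDirection π x q (π ν) := by
  obtain ⟨⟨v₀, hv₀, rfl⟩, hunit, horth⟩ := hν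
  have hht : ∀ v, ht (differential x q v) = 0 := fun v => by
    rw [hF.height_eq, lorentz_comm, hN.normal, neg_zero]
  have hin : ∀ v w, lorentz (differential x q v) (differential x q w) =
      inner ℝ (π (differential x q v)) (π (differential x q w)) := fun v w => by
    rw [hF.lorentz_eq, hht, zero_mul, sub_zero]
  rw [hin, real_inner_self_eq_norm_sq] at hunit
  refine ⟨(pow_eq_one_iff_of_nonneg (norm_nonneg _) two_ne_zero).1 hunit, v₀ 0, hv₀, fun v => ?_⟩
  have h1 := horth (differential x q (v₀ 0 • v - v 0 • v₀))
    ⟨_, by simp [mul_comm], rfl⟩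
  rw [hin, map_sub, map_smul, map_smul, map_sub, map_smul, map_smul, inner_sub_right,
    inner_smul_right, inner_smul_right, real_inner_self_eq_norm_sq, hunit] at h1
  linarith

end Direction

theorem IsGraphOver.of_subset {p N : E3} {S S' D : Set E3} {u v : E3 → ℝ}
    (hG : IsGraphOver p N S D u) (hS : S' ⊆ S)
    (hv : ∀ w ∈ D, p + w + u w • N ∈ S' → v w = u w) :
    IsGraphOver p N S' {w | w ∈ D ∧ p + w + u w • N ∈ S'} v := by
  refine ⟨fun w hw => hG.1 w hw.1, Set.Subset.antisymm (fun y hy => ?_) ?_⟩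
  · obtain ⟨w, hw, rfl⟩ : y ∈ {y | ∃ w ∈ D, y = p + w + u w • N} := hG.2 ▸ hS hy
    exact ⟨w, ⟨hw, hy⟩, by rw [hv w hw hy]⟩
  · rintro _ ⟨w, hw, rfl⟩
    rw [hv w hw.1 hw.2]
    exact hw.2

end LorentzMinkowski

/-! ### The maximum principle for surfaces -/

theorem mainTheorem2
    {M₁ : Type*} [TopologicalSpace M₁] [ChartedSpace (EuclideanHalfSpace 2) M₁]
    [IsManifold (𝓡∂ 2) ∞ M₁]
    {M₂ : Type*} [TopologicalSpace M₂] [ChartedSpace (EuclideanHalfSpace 2) M₂]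
    [IsManifold (𝓡∂ 2) ∞ M₂]
    (x₁ N₁ : M₁ → LorentzMinkowski.E3) (x₂ N₂ : M₂ → LorentzMinkowski.E3)
    (hx₁ : LorentzMinkowski.IsSpacelikeImmersion x₁)
    (hx₂ : LorentzMinkowski.IsSpacelikeImmersion x₂)
    (hN₁ : LorentzMinkowski.IsGaussMap x₁ N₁)
    (hN₂ : LorentzMinkowski.IsGaussMap x₂ N₂)
    (h : ℝ)
    (hH₁ : ∀ q, LorentzMinkowski.meanCurvature x₁ N₁ q = h)
    (hH₂ : ∀ q, LorentzMinkowski.meanCurvature x₂ N₂ q = h)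
    (q₁ : M₁) (q₂ : M₂) (p N : LorentzMinkowski.E3)
    (hp₁ : x₁ q₁ = p) (hp₂ : x₂ q₂ = p)
    (hNp₁ : N₁ q₁ = N) (hNp₂ : N₂ q₂ = N)
    (hbd : (𝓡∂ 2).IsBoundaryPoint q₁ → (𝓡∂ 2).IsBoundaryPoint q₂ →
      LorentzMinkowski.boundaryTangentLine x₁ q₁ = LorentzMinkowski.boundaryTangentLine x₂ q₂ ∧
      ∃ ν, LorentzMinkowski.IsInteriorConormal x₁ q₁ ν ∧
        LorentzMinkowski.IsInteriorConormal x₂ q₂ ν)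
    (hle : LorentzMinkowski.LiesBelow p N x₁ q₁ x₂ q₂) :
    (∃ V₁ ∈ 𝓝 q₁, ∃ V₂ ∈ 𝓝 q₂, ∃ D₁ D₂ : Set LorentzMinkowski.E3,
      ∃ u : LorentzMinkowski.E3 → ℝ,
        LorentzMinkowski.IsGraphOver p N (x₁ '' V₁) D₁ u ∧
        LorentzMinkowski.IsGraphOver p N (x₂ '' V₂) D₂ u) ∧
    (((𝓡∂ 2).IsInteriorPoint q₁ ∧ (𝓡∂ 2).IsInteriorPoint q₂) ∨
        LorentzMinkowski.SameGerm
          (fun a => LorentzMinkowski.tangentProj p N (x₁ a)) q₁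
          (fun b => LorentzMinkowski.tangentProj p N (x₂ b)) q₂ →
      LorentzMinkowski.SameGerm x₁ q₁ x₂ q₂) := by
  open LorentzMinkowski in
  have hNN : lorentz N N = -1 := hNp₁ ▸ hN₁.unit q₁
  obtain ⟨π, ht, hF⟩ := exists_isLorentzFrame hNN
  have hhtN := hF.height_normal hNN
  have hF₁ : IsLorentzFrame (N₁ q₁) π ht := hNp₁ ▸ hF
  have hF₂ : IsLorentzFrame (N₂ q₂) π ht := hNp₂ ▸ hF
  obtain ⟨W₁, hW₁, W₂, hW₂, D₁, D₂, u₁, u₂, hG₁, hG₂, hu⟩ := hle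
  have hperp : ∀ w, lorentz w N = 0 → ht w = 0 := fun w hw => by rw [hF.height_eq, hw, neg_zero]
  -- coordinates of the points of the two graphs
  have coord : ∀ {D : Set E3} {u : E3 → ℝ} {S : Set E3}, IsGraphOver p N S D u → ∀ y ∈ S,
      ∃ w ∈ D, y = p + w + u w • N ∧ ht w = 0 ∧ π (y - p) = π w ∧ ht (y - p) = u w := by
    rintro D u S ⟨hD, rfl⟩ y ⟨w, hw, rfl⟩
    have hw0 := hperp w (hD w hw)
    have e : p + w + u w • N - p = w + u w • N := by abel
    refine ⟨w, hw, rfl, hw0, ?_, ?_⟩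
    · rw [e, map_add, map_smul, hF.proj_normal, smul_zero, add_zero]
    · rw [e, map_add, map_smul, hw0, hhtN, zero_add, smul_eq_mul, mul_one]
  have hord : ∀ a ∈ W₁, ∀ b ∈ W₂, π (x₁ a - p) = π (x₂ b - p) →
      ht (x₁ a - p) ≤ ht (x₂ b - p) := by
    intro a ha b hb hab
    obtain ⟨w, hw, -, hw0, h1, h2⟩ := coord hG₁ (x₁ a) ⟨a, ha, rfl⟩
    obtain ⟨w', hw', -, hw0', h1', h2'⟩ := coord hG₂ (x₂ b) ⟨b, hb, rfl⟩
    obtain rfl : w = w' := hF.eq_of_eq (by rw [← h1, ← h1', hab]) (by rw [hw0, hw0'])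
    rw [h2, h2']
    exact hu w ⟨hw, hw'⟩
  -- a direction pointing into both surfaces
  obtain ⟨e, he, he₁, he₂⟩ : ∃ e : E2, ‖e‖ = 1 ∧
      (¬ (𝓡∂ 2).IsInteriorPoint q₁ → IsInnerDirection π x₁ q₁ e) ∧
      (¬ (𝓡∂ 2).IsInteriorPoint q₂ → IsInnerDirection π x₂ q₂ e) := by
    -- An interior point imposes no condition on `e`, so the other surface may dictate it; only two
    -- boundary points need the common conormal.
    by_cases i₁ : (𝓡∂ 2).IsInteriorPoint q₁
    · obtain ⟨e, he, hi⟩ := hx₂.exists_isInnerDirection hF q₂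
      exact ⟨e, he, fun hn => absurd i₁ hn, fun _ => hi⟩
    by_cases i₂ : (𝓡∂ 2).IsInteriorPoint q₂
    · obtain ⟨e, he, hi⟩ := hx₁.exists_isInnerDirection hF q₁
      exact ⟨e, he, fun _ => hi, fun hn => absurd i₂ hn⟩
    rw [ModelWithCorners.isInteriorPoint_iff_not_isBoundaryPoint, not_not] at i₁ i₂
    obtain ⟨-, ν, hν₁, hν₂⟩ := hbd i₁ i₂
    obtain ⟨hn, d₁⟩ := hN₁.isInnerDirection_conormal q₁ hF₁ hν₁
    obtain ⟨-, d₂⟩ := hN₂.isInnerDirection_conormal q₂ hF₂ hν₂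
    exact ⟨π ν, hn, fun _ => d₁, fun _ => d₂⟩
  have hc₁ : Filter.Tendsto (fun a => π (x₁ a - p)) (𝓝 q₁) (𝓝 0) := by
    have : Continuous fun a => π (x₁ a - p) :=
      π.continuous.comp (hx₁.smooth.continuous.sub continuous_const)
    simpa [hp₁] using this.tendsto q₁
  have hc₂ : Filter.Tendsto (fun b => π (x₂ b - p)) (𝓝 q₂) (𝓝 0) := by
    have : Continuous fun b => π (x₂ b - p) :=
      π.continuous.comp (hx₂.smooth.continuous.sub continuous_const)
    simpa [hp₂] using this.tendsto q₂
  have agree : ∃ V₁ ∈ 𝓝 q₁, ∃ V₂ ∈ 𝓝 q₂, V₁ ⊆ W₁ ∧ V₂ ⊆ W₂ ∧ ∀ a ∈ V₁, ∀ b ∈ V₂,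
      π (x₁ a - p) = π (x₂ b - p) → x₁ a = x₂ b := by
    obtain ⟨ρ₁, hρ₁, K₁, hK₁, g₁, v₁, ψ₁, Q₁, G₁⟩ :=
      exists_isLocalGraph hx₁ hN₁ hH₁ q₁ hF₁ hW₁ he he₁
    obtain ⟨ρ₂, hρ₂, K₂, hK₂, g₂, v₂, ψ₂, Q₂, G₂⟩ :=
      exists_isLocalGraph hx₂ hN₂ hH₂ q₂ hF₂ hW₂ he he₂
    rw [hp₁] at G₁
    rw [hp₂] at G₂
    obtain ⟨η, hη, heq⟩ := G₁.eventually_eq he hρ₁ hρ₂ hK₁ hK₂ G₂ hord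
    refine ⟨_, Filter.inter_mem hW₁ (Filter.inter_mem G₁.eventually_mem
      (hc₁ (Metric.ball_mem_nhds 0 hη))), _, Filter.inter_mem hW₂ G₂.eventually_mem,
      Set.inter_subset_left, Set.inter_subset_left, ?_⟩
    rintro a ⟨-, ⟨ha1, ha2⟩, ha3⟩ b ⟨-, hb1, hb2⟩ hab
    have ha3' : ‖π (x₁ a - p)‖ < η := mem_ball_zero_iff.1 ha3
    have h1 : ht (x₁ a - p) = ht (x₂ b - p) := by
      rw [← ha2, ← hb2, ← hab]
      exact heq _ ha3' ha1 (hab ▸ hb1)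
    exact sub_left_injective (hF.eq_of_eq hab h1)
  obtain ⟨V₁, hV₁, V₂, hV₂, hVW₁, hVW₂, hag⟩ := agree
  refine ⟨?_, ?_⟩
  · classical
    refine ⟨V₁, hV₁, V₂, hV₂, _, _,
      -- Glue the two height functions; on the overlap of the shrunken domains they agree by `hag`.
      fun w => if w ∈ D₁ ∧ p + w + u₁ w • N ∈ x₁ '' V₁ then u₁ w else u₂ w,
      hG₁.of_subset (Set.image_mono hVW₁) fun w hw hmem => if_pos ⟨hw, hmem⟩,
      hG₂.of_subset (Set.image_mono hVW₂) fun w hw => ?_⟩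
    rintro ⟨b, hb, hxb⟩
    split_ifs with hif
    · obtain ⟨hw', a, ha, hxa⟩ := hif
      have hab : x₁ a = x₂ b := hag a ha b hb (by
        rw [hxa, hxb]
        simp [add_sub_assoc, hF.proj_normal, add_comm p])
      rw [hxa, hxb] at hab
      simpa [hhtN] using congrArg ht (add_left_cancel hab)
    · rfl
  · rintro (⟨i₁, i₂⟩ | hgerm)
    · intro U₁ hU₁ U₂ hU₂
      -- Local graphs are rebuilt inside `Uᵢ ∩ Vᵢ`. At interior points both cover a full disc, so
      -- each point over the smaller disc has a partner on the other surface, equal to it by `hag`.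
      obtain ⟨ρ₁, hρ₁, K₁, hK₁, g₁, v₁, ψ₁, Q₁, G₁⟩ :=
        exists_isLocalGraph hx₁ hN₁ hH₁ q₁ hF₁ (Filter.inter_mem hU₁ hV₁) he he₁
      obtain ⟨ρ₂, hρ₂, K₂, hK₂, g₂, v₂, ψ₂, Q₂, G₂⟩ :=
        exists_isLocalGraph hx₂ hN₂ hH₂ q₂ hF₂ (Filter.inter_mem hU₂ hV₂) he he₂
      rw [hp₁] at G₁
      rw [hp₂] at G₂
      have hρ : 0 < min ρ₁ ρ₂ := lt_min hρ₁ hρ₂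
      refine ⟨_, Filter.inter_mem (Filter.inter_mem hU₁ hV₁) (hc₁ (Metric.ball_mem_nhds 0 hρ)), _,
        Filter.inter_mem (Filter.inter_mem hU₂ hV₂) (hc₂ (Metric.ball_mem_nhds 0 hρ)),
        fun a ha => ha.1.1, fun b hb => hb.1.1, ?_⟩
      apply Set.Subset.antisymm
      · rintro _ ⟨a, ⟨ha, hay⟩, rfl⟩
        have hy := Metric.ball_subset_ball (min_le_right ρ₁ ρ₂) hay
        obtain ⟨b, hb, hab, -⟩ := G₂.exists_eq _ hy (G₂.interior i₂ _ hy).le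
        exact ⟨b, ⟨hb, by rwa [Set.mem_preimage, hab]⟩, (hag a ha.2 b hb.2 hab.symm).symm⟩
      · rintro _ ⟨b, ⟨hb, hby⟩, rfl⟩
        have hy := Metric.ball_subset_ball (min_le_left ρ₁ ρ₂) hby
        obtain ⟨a, ha, hab, -⟩ := G₁.exists_eq _ hy (G₁.interior i₁ _ hy).le
        exact ⟨a, ⟨ha, by rwa [Set.mem_preimage, hab]⟩, hag a ha.2 b hb.2 hab⟩
    · intro U₁ hU₁ U₂ hU₂
      obtain ⟨Z₁, hZ₁, Z₂, hZ₂, hs₁, hs₂, himg⟩ := hgerm (U₁ ∩ V₁) (Filter.inter_mem hU₁ hV₁)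
        (U₂ ∩ V₂) (Filter.inter_mem hU₂ hV₂)
      have hproj : ∀ a b, tangentProj p N (x₁ a) = tangentProj p N (x₂ b) →
          π (x₁ a - p) = π (x₂ b - p) := fun a b hab => by
        rw [← hF.proj_tangentProj, ← hF.proj_tangentProj, hab]
      refine ⟨Z₁, hZ₁, Z₂, hZ₂, fun a ha => (hs₁ ha).1, fun b hb => (hs₂ hb).1, ?_⟩
      apply Set.Subset.antisymm
      · rintro _ ⟨a, ha, rfl⟩
        obtain ⟨b, hb, hab⟩ : tangentProj p N (x₁ a) ∈ (fun b => tangentProj p N (x₂ b)) '' Z₂ :=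
          himg ▸ ⟨a, ha, rfl⟩
        exact ⟨b, hb, (hag a (hs₁ ha).2 b (hs₂ hb).2 (hproj a b hab.symm)).symm⟩
      · rintro _ ⟨b, hb, rfl⟩
        obtain ⟨a, ha, hab⟩ : tangentProj p N (x₂ b) ∈ (fun a => tangentProj p N (x₁ a)) '' Z₁ :=
          himg ▸ ⟨b, hb, rfl⟩
        exact ⟨a, ha, hag a (hs₁ ha).2 b (hs₂ hb).2 (hproj a b hab)⟩
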